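/- A partition is identified with its Young diagram, $|\lambda|$ denotes its number of boxes, and $\nu'_j$ denotes the number of boxes in the $j$-th column of $\nu$. Let $s_\lambda$ denote the Schur function of $\lambda$ in the ring of symmetric functions over $\mathbb{Z}$, that is, the sequence of the Schur polynomials $s_\lambda(x_1,\dots,x_n)=\sum_T\prod_{\alpha\in\lambda}x_{T(\alpha)}$, $n\geqslant 0$, summed over the semistandard tableaux $T$ of shape $\lambda$ with entries in $\{1,\dots,n\}$. A reverse $\lambda$-tableau is a filling of the boxes of $\lambda$ with positive integers which weakly decrease along the rows and strictly decrease down the columns; it is called $\nu$-bounded if $T(1,j)\leqslant\nu'_j$ for all $j=1,\dots,\lambda_1$. The column word of $T$ is the sequence of all its entries, read by columns from left to right and from bottom to top in each column. A chain from $\mu$ to $\nu$ is a sequence of diagrams $\mu=\rho^{(0)}\to\rho^{(1)}\to\dots\to\rho^{(l)}=\nu$ in which each $\rho^{(i)}$ is obtained from $\rho^{(i-1)}$ by adding one box, and its Yamanouchi symbol is the sequence $r_1r_2\dots r_l$, where $r_i$ is the number of the row of the box added to $\rho^{(i-1)}$. Let $\lambda$ and $\mu$ be partitions. There is a unique family of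 integers $(c^\nu_{\lambda\mu})_\nu$ (the Littlewood–Richardson coefficients), only finitely many of them nonzero, such that $$s_\lambda\,s_\mu=\sum_\nu c^\nu_{\lambda\mu}\,s_\nu .$$ For every partition $\nu$ with $|\nu|=|\lambda|+|\mu|$, the coefficient $c^\nu_{\lambda\mu}$ equals the number of $\nu$-bounded reverse $\lambda$-tableaux whose column word is the Yamanouchi symbol of some chain from $\mu$ to $\nu$. Moreover, $c^\nu_{\lambda\mu}$ also equals the number of all reverse $\lambda$-tableaux (not necessarily $\nu$-bounded) whose column word is the Yamanouchi symbol of some chain from $\mu$ to $\nu$; in particular, there are finitely many of them. -/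

import Mathlib

/-- The semistandard tableaux of shape `lam` with entries in `{0, …, n - 1}`. -/
abbrev BoundedSSYT (n : ℕ) (lam : YoungDiagram) : Type :=
  {T : SemistandardYoungTableau lam // ∀ p ∈ lam.cells, T p.1 p.2 < n}

instance instFiniteBoundedSSYT (n : ℕ) (lam : YoungDiagram) : Finite (BoundedSSYT n lam) := by
  refine Finite.of_injective
    (fun (T : BoundedSSYT n lam) (p : lam.cells) => (⟨T.1 p.1.1 p.1.2, T.2 p.1 p.2⟩ : Fin n)) ?_
  intro T U h
  apply Subtype.ext
  apply SemistandardYoungTableau.ext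
  intro i j
  by_cases hm : (i, j) ∈ lam
  · exact congrArg Fin.val (congrFun h ⟨(i, j), hm⟩)
  · rw [T.1.zeros hm, U.1.zeros hm]

noncomputable instance instFintypeBoundedSSYT (n : ℕ) (lam : YoungDiagram) :
    Fintype (BoundedSSYT n lam) := Fintype.ofFinite _

/-- The Schur polynomial `s_lam` in `n` variables: the sum of the monomials
`∏_{p ∈ lam} x_{T(p)}` over the semistandard tableaux `T` of shape `lam` with entries indexing
the `n` variables. -/
noncomputable def schurPoly (n : ℕ) (lam : YoungDiagram) : MvPolynomial (Fin n) ℤ :=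
  ∑ T : BoundedSSYT n lam, ∏ p : lam.cells,
    MvPolynomial.X (⟨T.1 p.1.1 p.1.2, T.2 p.1 p.2⟩ : Fin n)

/-- The family `c` consists of the coefficients of the expansion
`s_lam * s_mu = ∑_nu c_nu s_nu` in the ring of symmetric functions. An element of that ring
(the inverse limit, over `n`, of the rings of symmetric polynomials in `n` variables) is the
sequence of its images in finitely many variables, and the Schur function `s_lam` is the sequence
of the Schur polynomials; so the identity is required for every number of variables, with
the same coefficients. -/
def IsSchurProductExpansion (lam mu : YoungDiagram) (c : YoungDiagram →₀ ℤ) : Prop :=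
  ∀ n : ℕ, schurPoly n lam * schurPoly n mu = c.sum fun nu m => m • schurPoly n nu

/-- A reverse tableau of shape `lam`: the boxes of `lam` are filled with positive integers that
weakly decrease along the rows and strictly decrease down the columns. Rows and columns are
numbered from `0` here, and the entry function is `0` outside `lam`. -/
structure ReverseTableau (lam : YoungDiagram) where
  entry : ℕ → ℕ → ℕ
  pos : ∀ {i j : ℕ}, (i, j) ∈ lam → 1 ≤ entry i j
  row_weak : ∀ {i j₁ j₂ : ℕ}, j₁ < j₂ → (i, j₂) ∈ lam → entry i j₂ ≤ entry i j₁
  col_strict : ∀ {i₁ i₂ j : ℕ}, i₁ < i₂ → (i₂, j) ∈ lam → entry i₂ j < entry i₁ j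
  zeros : ∀ {i j : ℕ}, (i, j) ∉ lam → entry i j = 0

/-- `T` is `nu`-bounded: each entry of its first row is at most the length of the column of `nu`
with the same column number. -/
def ReverseTableau.IsBounded {lam : YoungDiagram} (T : ReverseTableau lam)
    (nu : YoungDiagram) : Prop :=
  ∀ j < lam.rowLen 0, T.entry 0 j ≤ nu.colLen j

/-- The column word: the entries read by columns from left to right, and from bottom to top in
each column. -/
def ReverseTableau.columnWord {lam : YoungDiagram} (T : ReverseTableau lam) : List ℕ :=
  (List.range (lam.rowLen 0)).flatMap fun j =>
    (List.range (lam.colLen j)).reverse.map fun i => T.entry i j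

/-- `sigma` is obtained from `rho` by adding one box, in row number `r`, where the rows
are numbered from `1`. -/
def AddsBoxInRow (rho sigma : YoungDiagram) (r : ℕ) : Prop :=
  ∃ i j : ℕ, r = i + 1 ∧ (i, j) ∉ rho ∧ sigma.cells = insert (i, j) rho.cells

/-- The word `w = r₁ … r_l` is the Yamanouchi symbol of some chain of diagrams
`mu = rho 0 → rho 1 → … → rho l = nu`, each obtained from the previous one by adding one box, with
`r_k` the number of the row of the box added in the `k`-th step. (Values of `rho` beyond `l`
play no role.) -/
def IsYamanouchiSymbol (mu nu : YoungDiagram) (w : List ℕ) : Prop :=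
  ∃ rho : ℕ → YoungDiagram, rho 0 = mu ∧ rho w.length = nu ∧
    ∀ (k : ℕ) (hk : k < w.length), AddsBoxInRow (rho k) (rho (k + 1)) w[k]

/-!
The proof is Stembridge's cancellation argument, carried out on reverse tableaux.

Let `a_α = ∑_σ sgn(σ) x^(α ∘ σ)` be the alternant of `α` in `n` variables and
`ρ = (n - 1, …, 1, 0)`. Subtracting entries from `n` and reversing the variables turns the Schur
polynomial into the generating function of the reverse tableaux with entries at most `n`, by
symmetry of the latter; and symmetry also gives
`a_(μ + ρ) * s_λ = ∑_T a_(μ + ρ + wt T)`, the sum over these tableaux `T`. Say that `T` is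
dominant if `μ` plus the content of the first `J` columns is a partition for every `J`. If `T` is
not dominant, take the first failing `J`, and then the first failing pair of rows `k`, `k + 1`.
The `J`-th column contains `k + 2` but not `k + 1` (rows are numbered from `0`, entries from `1`),
so the Bender–Knuth involution for these two entries can be applied to the later columns alone. It
preserves the place of the first failure and exchanges the coordinates `k` and `k + 1` of
`μ + ρ + wt T`, hence changes the sign of the alternant. So only dominant tableaux
remain (`alternant_mul_schurPoly`).

In a reverse tableau the columns from `J` on form again a reverse tableau of straight shape. This is
why the restricted involution is as simple as the full one: on the Gelfand–Tsetlin pattern of the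
numbers of entries greater than `m` in row `i`, cut off below at `J`, it reflects each entry of one
row in the interval allowed by interlacing (`ReverseTableau.toggle`); the case `J = 0` gives the
symmetry.

Adding the boxes of a vertical strip from top to bottom passes through diagrams only, so `T` is
dominant precisely if its column word is the Yamanouchi symbol of a chain from `μ`; the chain ends
in `μ + wt T` (`ReverseTableau.isYamanouchiSymbol_columnWord_iff`). Such a `T` is bounded by the
last diagram `ν` of the chain, because each of the first columns adds a box to a row at least as
long as the number of columns already read (`ReverseTableau.entry_zero_le_colLen`). For `μ = ∅`
this squeezes `λ'_j ≤ T(1, j) ≤ ν'_j` with `|ν| = |λ|`, so that `ν = λ` and only one tableau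
remains: this is the bialternant formula `a_ρ * s_λ = a_(λ + ρ)`. Cancelling `a_ρ` gives the product
formula in any number of variables, and comparing leading coefficients of alternants shows that
the coefficients are unique.
-/

open Equiv

/-! ### Rows of reverse tableaux -/

namespace ReverseTableau

variable {lam : YoungDiagram}

theorem ext_entry {T U : ReverseTableau lam} (h : ∀ i j, T.entry i j = U.entry i j) : T = U := by
  cases T; cases U
  simp only [mk.injEq]
  funext i j
  exact h i j

theorem antitone_entry (T : ReverseTableau lam) (i : ℕ) : Antitone (T.entry i) := by
  intro j₁ j₂ h
  by_cases hm : (i, j₂) ∈ lam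
  · rcases h.eq_or_lt with rfl | h
    · exact le_rfl
    · exact T.row_weak h hm
  · rw [T.zeros hm]
    exact Nat.zero_le _

theorem mem_of_entry_pos (T : ReverseTableau lam) {i j : ℕ} (h : 0 < T.entry i j) :
    (i, j) ∈ lam := by
  by_contra hm
  rw [T.zeros hm] at h
  exact h.false

theorem exists_entry_le (T : ReverseTableau lam) (m i : ℕ) : ∃ j, T.entry i j ≤ m := by
  refine ⟨lam.rowLen i, ?_⟩
  rw [T.zeros (by rw [YoungDiagram.mem_iff_lt_rowLen]; exact lt_irrefl _)]
  exact Nat.zero_le _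

/-- The number of entries greater than `m` in row `i`. For fixed `T` these numbers form the
Gelfand–Tsetlin pattern of `T`. -/
def rowGT (T : ReverseTableau lam) (m i : ℕ) : ℕ := Nat.find (T.exists_entry_le m i)

theorem lt_rowGT (T : ReverseTableau lam) {m i j : ℕ} :
    j < T.rowGT m i ↔ m < T.entry i j := by
  rw [rowGT, Nat.lt_find_iff]
  constructor
  · intro h
    exact not_le.1 (h j le_rfl)
  · intro h j' hj'
    exact not_le.2 (h.trans_le (T.antitone_entry i hj'))

/-- The number of entries greater than `m` in row `i`, where those in the first `J` columns are
replaced by `J` fictitious ones; so only the columns from `J` on matter. -/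
def cutGT (T : ReverseTableau lam) (J m i : ℕ) : ℕ := max (T.rowGT m i) J

theorem le_cutGT (T : ReverseTableau lam) (J m i : ℕ) : J ≤ T.cutGT J m i := le_max_right _ _

theorem lt_cutGT (T : ReverseTableau lam) {J m i j : ℕ} (h : J ≤ j) :
    j < T.cutGT J m i ↔ m < T.entry i j := by
  rw [cutGT, lt_max_iff, lt_rowGT]
  omega

theorem cutGT_le {T : ReverseTableau lam} {J m i b : ℕ} (hb : J ≤ b)
    (h : ∀ j, J ≤ j → m < T.entry i j → j < b) : T.cutGT J m i ≤ b := by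
  by_contra! hlt
  exact (h b hb ((T.lt_cutGT hb).1 hlt)).false

theorem cutGT_antitone (T : ReverseTableau lam) (J i : ℕ) {m m' : ℕ} (h : m ≤ m') :
    T.cutGT J m' i ≤ T.cutGT J m i :=
  cutGT_le (T.le_cutGT _ _ _) fun _ hj hm => (T.lt_cutGT hj).2 (h.trans_lt hm)

theorem cutGT_succ_le (T : ReverseTableau lam) (J m i : ℕ) :
    T.cutGT J m (i + 1) ≤ T.cutGT J (m + 1) i := by
  refine cutGT_le (T.le_cutGT _ _ _) fun j hj hm => (T.lt_cutGT hj).2 ?_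
  have := T.col_strict (Nat.lt_add_one i) (T.mem_of_entry_pos (Nat.zero_lt_of_lt hm))
  omega

/-! ### Toggling a row of the Gelfand–Tsetlin pattern -/

/-- The least value that interlacing with the neighbouring rows `k` and `k + 2` of the
Gelfand–Tsetlin pattern allows for its entry `(k + 1, i)`. -/
def toggleLower (T : ReverseTableau lam) (J k i : ℕ) : ℕ :=
  max (T.cutGT J k (i + 1)) (T.cutGT J (k + 2) i)

/-- The greatest value that interlacing with the neighbouring rows `k` and `k + 2` of the
Gelfand–Tsetlin pattern allows for its entry `(k + 1, i)`. -/
def toggleUpper (T : ReverseTableau lam) (J k : ℕ) : ℕ → ℕ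
  | 0 => T.cutGT J k 0
  | i + 1 => min (T.cutGT J k (i + 1)) (T.cutGT J (k + 2) i)

/-- The reflection of the entry `(k + 1, i)` of the Gelfand–Tsetlin pattern in the interval
of its allowed values. -/
def toggleVal (T : ReverseTableau lam) (J k i : ℕ) : ℕ :=
  T.toggleLower J k i + T.toggleUpper J k i - T.cutGT J (k + 1) i

theorem toggleLower_le (T : ReverseTableau lam) (J k i : ℕ) :
    T.toggleLower J k i ≤ T.cutGT J (k + 1) i :=
  max_le (T.cutGT_succ_le J k i) (T.cutGT_antitone J i (by omega))

theorem le_toggleUpper (T : ReverseTableau lam) (J k i : ℕ) :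
    T.cutGT J (k + 1) i ≤ T.toggleUpper J k i := by
  cases i with
  | zero => exact T.cutGT_antitone J 0 (by omega)
  | succ i => exact le_min (T.cutGT_antitone J _ (by omega)) (T.cutGT_succ_le J (k + 1) i)

theorem toggleUpper_le (T : ReverseTableau lam) (J k i : ℕ) :
    T.toggleUpper J k i ≤ T.cutGT J k i := by
  cases i with
  | zero => exact le_rfl
  | succ i => exact min_le_left _ _

theorem toggleLower_le_toggleVal (T : ReverseTableau lam) (J k i : ℕ) :
    T.toggleLower J k i ≤ T.toggleVal J k i := by
  have := T.le_toggleUpper J k i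
  unfold toggleVal
  omega

theorem toggleVal_le_toggleUpper (T : ReverseTableau lam) (J k i : ℕ) :
    T.toggleVal J k i ≤ T.toggleUpper J k i := by
  have := T.toggleLower_le J k i
  unfold toggleVal
  omega

theorem cutGT_le_toggleVal (T : ReverseTableau lam) (J k i : ℕ) :
    T.cutGT J (k + 2) i ≤ T.toggleVal J k i :=
  (le_max_right _ _).trans (T.toggleLower_le_toggleVal J k i)

theorem toggleVal_le_cutGT (T : ReverseTableau lam) (J k i : ℕ) :
    T.toggleVal J k i ≤ T.cutGT J k i :=
  (T.toggleVal_le_toggleUpper J k i).trans (T.toggleUpper_le J k i)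

theorem le_toggleVal (T : ReverseTableau lam) (J k i : ℕ) : J ≤ T.toggleVal J k i :=
  (T.le_cutGT _ _ _).trans (T.cutGT_le_toggleVal J k i)

/-- The entries of the toggled tableau. -/
def toggleEntry (T : ReverseTableau lam) (J k i j : ℕ) : ℕ :=
  if J ≤ j ∧ (T.entry i j = k + 1 ∨ T.entry i j = k + 2) then
    if j < T.toggleVal J k i then k + 2 else k + 1
  else T.entry i j

theorem toggleEntry_of_lt (T : ReverseTableau lam) {J k i j : ℕ} (h : j < J) :
    T.toggleEntry J k i j = T.entry i j := by
  rw [toggleEntry, if_neg (by omega)]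

theorem toggleEntry_of_ne (T : ReverseTableau lam) {J k i j : ℕ} (h₁ : T.entry i j ≠ k + 1)
    (h₂ : T.entry i j ≠ k + 2) : T.toggleEntry J k i j = T.entry i j := by
  rw [toggleEntry, if_neg (by omega)]

theorem toggleEntry_of_mem (T : ReverseTableau lam) {J k i j : ℕ} (hj : J ≤ j)
    (h : T.entry i j = k + 1 ∨ T.entry i j = k + 2) :
    T.toggleEntry J k i j = if j < T.toggleVal J k i then k + 2 else k + 1 := by
  rw [toggleEntry, if_pos ⟨hj, h⟩]

theorem toggleEntry_cases (T : ReverseTableau lam) (J k i j : ℕ) :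
    T.toggleEntry J k i j = T.entry i j ∨
      J ≤ j ∧ (T.entry i j = k + 1 ∨ T.entry i j = k + 2) ∧
        (T.toggleEntry J k i j = k + 1 ∨ T.toggleEntry J k i j = k + 2) := by
  unfold toggleEntry
  split_ifs <;> omega

theorem lt_toggleEntry (T : ReverseTableau lam) {J k i j : ℕ} (hj : J ≤ j) :
    k + 1 < T.toggleEntry J k i j ↔ j < T.toggleVal J k i := by
  have h₁ := (T.lt_cutGT (m := k) (i := i) hj)
  have h₂ := (T.lt_cutGT (m := k + 2) (i := i) hj)
  have h₃ := T.cutGT_le_toggleVal J k i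
  have h₄ := T.toggleVal_le_cutGT J k i
  unfold toggleEntry
  split_ifs <;> omega

/-- No entry `k + 1` occurs in the last one of the first `J` columns. This makes it possible to
change entries `k + 1` to `k + 2` in the columns from `J` on. -/
def Separated (T : ReverseTableau lam) (J k : ℕ) : Prop :=
  ∀ i j, j + 1 = J → T.entry i j ≠ k + 1

theorem toggleEntry_succ_lt (T : ReverseTableau lam) {J k i j : ℕ} (h : (i + 1, j) ∈ lam) :
    T.toggleEntry J k (i + 1) j < T.toggleEntry J k i j := by
  have hlt := T.col_strict (Nat.lt_add_one i) h
  rcases lt_or_ge j J with hj | hj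
  · rwa [T.toggleEntry_of_lt hj, T.toggleEntry_of_lt hj]
  · by_cases hc : T.entry (i + 1) j = k + 1 ∧ T.entry i j = k + 2
    · have h₁ : j < T.toggleVal J k i := lt_of_lt_of_le ((T.lt_cutGT hj).2 (by omega))
        ((le_max_left _ _).trans (T.toggleLower_le_toggleVal J k i))
      have h₂ : ¬ j < T.toggleVal J k (i + 1) := fun hlt' => by
        have := (T.lt_cutGT hj).1 (hlt'.trans_le
          ((T.toggleVal_le_toggleUpper J k (i + 1)).trans (min_le_right _ _)))
        omega
      rw [T.toggleEntry_of_mem hj (by omega), T.toggleEntry_of_mem hj (by omega), if_pos h₁,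
        if_neg h₂]
      omega
    · have h₁ := T.toggleEntry_cases J k i j
      have h₂ := T.toggleEntry_cases J k (i + 1) j
      omega

/-- The Bender–Knuth involution, restricted to the columns from `J` on: it exchanges the numbers
of entries `k + 1` and `k + 2` there. On the Gelfand–Tsetlin pattern it is a toggle of one row. -/
def toggle (T : ReverseTableau lam) (J k : ℕ) (hT : T.Separated J k) : ReverseTableau lam where
  entry := T.toggleEntry J k
  pos {i j} h := by
    have h₁ := T.pos h
    have h₂ := T.toggleEntry_cases J k i j
    omega
  row_weak {i j₁ j₂} h _ := by
    have hle := T.antitone_entry i h.le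
    have h₁ := T.toggleEntry_cases J k i j₁
    have h₂ := T.toggleEntry_cases J k i j₂
    rcases lt_or_ge j₁ J with hj₁ | hj₁
    · rw [T.toggleEntry_of_lt hj₁]
      -- an entry `k + 1` at `j₁` would extend to the column before `J`
      by_cases hc : T.entry i j₁ = k + 1 ∧ T.entry i j₂ = k + 1 ∧ J ≤ j₂
      · have h₃ := hT i (J - 1) (by omega)
        have h₄ := T.antitone_entry i (show j₁ ≤ J - 1 by omega)
        have h₅ := T.antitone_entry i (show J - 1 ≤ j₂ by omega)
        omega
      · omega
    · have h₃ := T.lt_toggleEntry (k := k) (i := i) hj₁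
      have h₄ := T.lt_toggleEntry (k := k) (i := i) (hj₁.trans h.le)
      omega
  col_strict {i₁ i₂ j} h := by
    induction i₂, h using Nat.le_induction with
    | base => exact fun hm => T.toggleEntry_succ_lt hm
    | succ i _ ih =>
      intro hm
      exact (T.toggleEntry_succ_lt hm).trans
        (ih (lam.up_left_mem (Nat.le_succ i) le_rfl hm))
  zeros {i j} h := by
    have h₁ := T.zeros h
    rw [T.toggleEntry_of_ne (by omega) (by omega), h₁]

variable {T : ReverseTableau lam} {J k : ℕ}

@[simp]
theorem toggle_entry (hT : T.Separated J k) (i j : ℕ) :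
    (T.toggle J k hT).entry i j = T.toggleEntry J k i j := rfl

theorem toggle_separated (hT : T.Separated J k) : (T.toggle J k hT).Separated J k := by
  intro i j hj
  rw [toggle_entry, T.toggleEntry_of_lt (by omega)]
  exact hT i j hj

theorem cutGT_congr {T U : ReverseTableau lam} {J m m' i : ℕ}
    (h : ∀ j, J ≤ j → (m < T.entry i j ↔ m' < U.entry i j)) : T.cutGT J m i = U.cutGT J m' i :=
  le_antisymm
    (cutGT_le (U.le_cutGT _ _ _) fun j hj hm => (U.lt_cutGT hj).2 ((h j hj).1 hm))
    (cutGT_le (T.le_cutGT _ _ _) fun j hj hm => (T.lt_cutGT hj).2 ((h j hj).2 hm))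

theorem cutGT_toggle_of_ne (hT : T.Separated J k) {m : ℕ} (hm : m ≠ k + 1) (i : ℕ) :
    (T.toggle J k hT).cutGT J m i = T.cutGT J m i := by
  refine cutGT_congr fun j hj => ?_
  have h₁ := T.toggleEntry_cases J k i j
  rw [toggle_entry]
  omega

theorem cutGT_toggle (hT : T.Separated J k) (i : ℕ) :
    (T.toggle J k hT).cutGT J (k + 1) i = T.toggleVal J k i := by
  refine le_antisymm (cutGT_le (T.le_toggleVal J k i) fun j hj hm => ?_) ?_
  · exact (T.lt_toggleEntry hj).1 hm
  · by_contra! hlt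
    have h₁ := le_cutGT (T.toggle J k hT) J (k + 1) i
    exact (((T.toggle J k hT).lt_cutGT h₁).2 ((T.lt_toggleEntry h₁).2 hlt)).false

theorem toggleLower_toggle (hT : T.Separated J k) (i : ℕ) :
    (T.toggle J k hT).toggleLower J k i = T.toggleLower J k i := by
  simp only [toggleLower]
  rw [cutGT_toggle_of_ne hT (by omega), cutGT_toggle_of_ne hT (by omega)]

theorem toggleUpper_toggle (hT : T.Separated J k) (i : ℕ) :
    (T.toggle J k hT).toggleUpper J k i = T.toggleUpper J k i := by
  cases i with
  | zero => exact cutGT_toggle_of_ne hT (by omega) 0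
  | succ i =>
    simp only [toggleUpper]
    rw [cutGT_toggle_of_ne hT (by omega), cutGT_toggle_of_ne hT (by omega)]

theorem toggleVal_toggle (hT : T.Separated J k) (i : ℕ) :
    (T.toggle J k hT).toggleVal J k i = T.cutGT J (k + 1) i := by
  rw [toggleVal, toggleLower_toggle, toggleUpper_toggle, cutGT_toggle, toggleVal]
  have h₁ := T.toggleLower_le J k i
  have h₂ := T.le_toggleUpper J k i
  omega

theorem toggle_toggle (hT : T.Separated J k) :
    (T.toggle J k hT).toggle J k (toggle_separated hT) = T := by
  refine ext_entry fun i j => ?_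
  have h₁ := T.toggleEntry_cases J k i j
  have h₂ := (T.toggle J k hT).toggleEntry_cases J k i j
  rcases lt_or_ge j J with hj | hj
  · rw [toggle_entry, toggleEntry_of_lt _ hj, toggle_entry, toggleEntry_of_lt _ hj]
  · have h₃ := (T.toggle J k hT).lt_toggleEntry (k := k) (i := i) hj
    rw [toggleVal_toggle, T.lt_cutGT hj] at h₃
    rw [toggle_entry] at h₂ ⊢
    omega

/-- The toggle preserves the sum of a pattern row and its reflection, as
`max a b + min a b = a + b`. -/
theorem sum_toggleLower_add_toggleUpper (T : ReverseTableau lam) (J k N : ℕ) :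
    ∑ i ∈ Finset.range N, (T.toggleLower J k i + T.toggleUpper J k i) + T.toggleUpper J k N =
      ∑ i ∈ Finset.range N, (T.cutGT J k i + T.cutGT J (k + 2) i) + T.cutGT J k N := by
  induction N with
  | zero => simp [toggleUpper]
  | succ N ih =>
    rw [Finset.sum_range_succ, Finset.sum_range_succ]
    have := max_add_min (T.cutGT J k (N + 1)) (T.cutGT J (k + 2) N)
    simp only [toggleLower, toggleUpper] at ih ⊢
    omega

theorem cutGT_eq_of_le (T : ReverseTableau lam) {J m i : ℕ} (h : lam.colLen 0 ≤ i) :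
    T.cutGT J m i = J := by
  refine le_antisymm (cutGT_le le_rfl fun j _ hm => ?_) (T.le_cutGT _ _ _)
  have := lam.up_left_mem le_rfl (Nat.zero_le j) (T.mem_of_entry_pos (Nat.zero_lt_of_lt hm))
  rw [YoungDiagram.mem_iff_lt_colLen] at this
  omega

theorem sum_toggleVal_add (T : ReverseTableau lam) (J k : ℕ) :
    ∑ i ∈ Finset.range (lam.colLen 0), (T.toggleVal J k i + T.cutGT J (k + 1) i) =
      ∑ i ∈ Finset.range (lam.colLen 0), (T.cutGT J k i + T.cutGT J (k + 2) i) := by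
  have h := T.sum_toggleLower_add_toggleUpper J k (lam.colLen 0)
  have h₁ : T.cutGT J k (lam.colLen 0) = J := T.cutGT_eq_of_le le_rfl
  have h₂ := T.toggleUpper_le J k (lam.colLen 0)
  have h₃ := T.le_toggleVal J k (lam.colLen 0)
  have h₄ := T.toggleVal_le_toggleUpper J k (lam.colLen 0)
  have h₅ : ∑ i ∈ Finset.range (lam.colLen 0), (T.toggleVal J k i + T.cutGT J (k + 1) i) =
      ∑ i ∈ Finset.range (lam.colLen 0), (T.toggleLower J k i + T.toggleUpper J k i) := by
    refine Finset.sum_congr rfl fun i _ => ?_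
    have h₁ := T.toggleLower_le J k i
    have h₂ := T.le_toggleUpper J k i
    unfold toggleVal
    omega
  omega

/-! ### Content -/

/-- The number of entries `m + 1` in the columns before `J`. -/
def weightBefore (T : ReverseTableau lam) (J m : ℕ) : ℕ :=
  (lam.cells.filter fun p => p.2 < J ∧ T.entry p.1 p.2 = m + 1).card

/-- The number of entries `m + 1` in the columns from `J` on. -/
def weightFrom (T : ReverseTableau lam) (J m : ℕ) : ℕ :=
  (lam.cells.filter fun p => J ≤ p.2 ∧ T.entry p.1 p.2 = m + 1).card

/-- The number of entries `m + 1`. -/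
def weight (T : ReverseTableau lam) (m : ℕ) : ℕ :=
  (lam.cells.filter fun p => T.entry p.1 p.2 = m + 1).card

theorem weightBefore_add_weightFrom (T : ReverseTableau lam) (J m : ℕ) :
    T.weightBefore J m + T.weightFrom J m = T.weight m := by
  rw [weightBefore, weightFrom, weight,
    ← Finset.card_filter_add_card_filter_not (s := lam.cells.filter fun p =>
      T.entry p.1 p.2 = m + 1) (fun p => p.2 < J), Finset.filter_filter, Finset.filter_filter]
  simp only [not_lt, and_comm]

theorem weightFrom_add_sum (T : ReverseTableau lam) (J m : ℕ) :
    T.weightFrom J m + ∑ i ∈ Finset.range (lam.colLen 0), T.cutGT J (m + 1) i =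
      ∑ i ∈ Finset.range (lam.colLen 0), T.cutGT J m i := by
  rw [weightFrom, Finset.card_eq_sum_card_fiberwise (f := Prod.fst)
    (t := Finset.range (lam.colLen 0)), ← Finset.sum_add_distrib]
  · refine Finset.sum_congr rfl fun i _ => ?_
    have h₁ : ((lam.cells.filter fun p => J ≤ p.2 ∧ T.entry p.1 p.2 = m + 1).filter
        fun p => p.1 = i) =
        (Finset.Ico (T.cutGT J (m + 1) i) (T.cutGT J m i)).map
          (Function.Embedding.sectR i ℕ) := by
      ext ⟨a, j⟩
      simp only [Finset.mem_filter, YoungDiagram.mem_cells, Finset.mem_map, Finset.mem_Ico,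
        Function.Embedding.sectR_apply, Prod.mk.injEq]
      constructor
      · rintro ⟨⟨_, hj, he⟩, rfl⟩
        have h₂ := T.lt_cutGT (m := m) (i := a) hj
        have h₃ := T.lt_cutGT (m := m + 1) (i := a) hj
        exact ⟨j, by omega, rfl, rfl⟩
      · rintro ⟨j, hj', rfl, rfl⟩
        have hj := (T.le_cutGT J (m + 1) i).trans hj'.1
        have h₂ := T.lt_cutGT (m := m) (i := i) hj
        have h₃ := T.lt_cutGT (m := m + 1) (i := i) hj
        exact ⟨⟨T.mem_of_entry_pos (by omega), hj, by omega⟩, rfl⟩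
    rw [h₁, Finset.card_map, Nat.card_Ico]
    have := T.cutGT_antitone J i (Nat.le_add_right m 1)
    omega
  · rintro ⟨i, j⟩ hp
    simp only [Finset.coe_filter, YoungDiagram.mem_cells, Set.mem_ofPred_eq] at hp
    have := lam.up_left_mem le_rfl (Nat.zero_le j) hp.1
    rw [YoungDiagram.mem_iff_lt_colLen] at this
    simpa using this

theorem weightBefore_congr {T U : ReverseTableau lam} {J : ℕ}
    (h : ∀ i j, j < J → T.entry i j = U.entry i j) (m : ℕ) :
    T.weightBefore J m = U.weightBefore J m := by
  unfold weightBefore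
  congr 1
  refine Finset.filter_congr fun p _ => and_congr_right fun hp => ?_
  rw [h _ _ hp]

theorem weightBefore_toggle (hT : T.Separated J k) {J' : ℕ} (h : J' ≤ J) (m : ℕ) :
    (T.toggle J k hT).weightBefore J' m = T.weightBefore J' m :=
  weightBefore_congr (fun _ _ hj => T.toggleEntry_of_lt (hj.trans_le h)) m

theorem weightFrom_toggle_of_ne (hT : T.Separated J k) {m : ℕ} (h₁ : m ≠ k) (h₂ : m ≠ k + 1) :
    (T.toggle J k hT).weightFrom J m = T.weightFrom J m := by
  unfold weightFrom
  congr 1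
  refine Finset.filter_congr fun p _ => and_congr_right fun hp => ?_
  have := T.toggleEntry_cases J k p.1 p.2
  rw [toggle_entry]
  omega

theorem weightFrom_toggle_left (hT : T.Separated J k) :
    (T.toggle J k hT).weightFrom J k = T.weightFrom J (k + 1) := by
  have h₁ := (T.toggle J k hT).weightFrom_add_sum J k
  have h₂ := T.weightFrom_add_sum J (k + 1)
  rw [show k + 1 + 1 = k + 2 from rfl] at h₂
  have h₃ := T.sum_toggleVal_add J k
  simp only [cutGT_toggle hT, cutGT_toggle_of_ne hT (show k ≠ k + 1 by omega)] at h₁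
  simp only [Finset.sum_add_distrib] at h₃
  omega

theorem weightFrom_toggle_right (hT : T.Separated J k) :
    (T.toggle J k hT).weightFrom J (k + 1) = T.weightFrom J k := by
  have := weightFrom_toggle_left (toggle_separated hT)
  rwa [toggle_toggle, eq_comm] at this

end ReverseTableau

/-! ### Yamanouchi symbols -/

theorem addsBoxInRow_rowLen {rho sigma : YoungDiagram} {r : ℕ} (h : AddsBoxInRow rho sigma r)
    (i : ℕ) : sigma.rowLen i = rho.rowLen i + if i + 1 = r then 1 else 0 := by
  obtain ⟨i₀, j₀, rfl, hn, hc⟩ := h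
  have hmem : ∀ a b, (a, b) ∈ sigma ↔ (a = i₀ ∧ b = j₀) ∨ (a, b) ∈ rho := fun a b => by
    rw [← YoungDiagram.mem_cells, hc, Finset.mem_insert, Prod.mk.injEq, YoungDiagram.mem_cells]
  have hj : j₀ = rho.rowLen i₀ := by
    rw [YoungDiagram.mem_iff_lt_rowLen] at hn
    by_contra hne
    have h₁ : (i₀, rho.rowLen i₀) ∈ sigma :=
      sigma.up_left_mem le_rfl (not_lt.1 hn) ((hmem _ _).2 (Or.inl ⟨rfl, rfl⟩))
    rcases (hmem _ _).1 h₁ with h₂ | h₂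
    · exact hne h₂.2.symm
    · rw [YoungDiagram.mem_iff_lt_rowLen] at h₂
      exact h₂.false
  have hlt : ∀ b, b < sigma.rowLen i ↔ b < rho.rowLen i + if i + 1 = i₀ + 1 then 1 else 0 := by
    intro b
    rw [← YoungDiagram.mem_iff_lt_rowLen, hmem, YoungDiagram.mem_iff_lt_rowLen]
    by_cases hi : i = i₀
    · subst hi
      simp only [if_pos, true_and]
      omega
    · simp [hi]
  exact le_antisymm (le_of_forall_lt fun b hb => (hlt b).1 hb)
    (le_of_forall_lt fun b hb => (hlt b).2 hb)

theorem addsBoxInRow_card {rho sigma : YoungDiagram} {r : ℕ} (h : AddsBoxInRow rho sigma r) :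
    sigma.card = rho.card + 1 := by
  obtain ⟨i, j, -, hn, hc⟩ := h
  rw [YoungDiagram.card, hc, Finset.card_insert_of_notMem (by simpa using hn)]

theorem exists_addsBoxInRow {rho : YoungDiagram} {i : ℕ}
    (h : ∀ i', i' + 1 = i → rho.rowLen i < rho.rowLen i') :
    ∃ sigma, AddsBoxInRow rho sigma (i + 1) := by
  refine ⟨⟨insert (i, rho.rowLen i) rho.cells, ?_⟩, i, rho.rowLen i, rfl, ?_, rfl⟩
  · rintro ⟨a, b⟩ ⟨c, d⟩ hle hm
    obtain ⟨h₁, h₂⟩ := Prod.mk_le_mk.1 hle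
    simp only [Finset.coe_insert, Set.mem_insert_iff, Prod.mk.injEq, Finset.mem_coe,
      YoungDiagram.mem_cells] at hm ⊢
    rcases hm with ⟨rfl, rfl⟩ | hm
    · rw [YoungDiagram.mem_iff_lt_rowLen]
      rcases h₁.eq_or_lt with rfl | h₁
      · omega
      · have h₃ := h (a - 1) (by omega)
        have h₄ := rho.rowLen_anti c (a - 1) (by omega)
        omega
    · exact Or.inr (rho.up_left_mem h₁ h₂ hm)
  · rw [YoungDiagram.mem_iff_lt_rowLen]
    exact lt_irrefl _

theorem isYamanouchiSymbol_nil {mu nu : YoungDiagram} :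
    IsYamanouchiSymbol mu nu [] ↔ mu = nu := by
  constructor
  · rintro ⟨rho, rfl, rfl, -⟩
    rfl
  · rintro rfl
    exact ⟨fun _ => mu, rfl, rfl, fun k hk => absurd hk (Nat.not_lt_zero k)⟩

theorem isYamanouchiSymbol_singleton {mu nu : YoungDiagram} {r : ℕ} :
    IsYamanouchiSymbol mu nu [r] ↔ AddsBoxInRow mu nu r := by
  constructor
  · rintro ⟨rho, rfl, rfl, h⟩
    exact h 0 Nat.zero_lt_one
  · intro h
    refine ⟨fun t => if t = 0 then mu else nu, rfl, rfl, fun k hk => ?_⟩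
    obtain rfl : k = 0 := by simpa using hk
    exact h

theorem isYamanouchiSymbol_append {mu nu : YoungDiagram} {w₁ w₂ : List ℕ} :
    IsYamanouchiSymbol mu nu (w₁ ++ w₂) ↔
      ∃ rho, IsYamanouchiSymbol mu rho w₁ ∧ IsYamanouchiSymbol rho nu w₂ := by
  constructor
  · rintro ⟨rho, rfl, rfl, h⟩
    refine ⟨rho w₁.length, ⟨rho, rfl, rfl, fun k hk => ?_⟩,
      ⟨fun t => rho (w₁.length + t), rfl, by rw [List.length_append], fun k hk => ?_⟩⟩
    · have := h k (by rw [List.length_append]; omega)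
      rwa [List.getElem_append_left hk] at this
    · have := h (w₁.length + k) (by rw [List.length_append]; omega)
      rw [List.getElem_append_right (by omega)] at this
      simpa only [Nat.add_sub_cancel_left, add_assoc] using this
  · rintro ⟨_, ⟨rho₁, rfl, rfl, h₁⟩, ⟨rho₂, h₀, rfl, h₂⟩⟩
    refine ⟨fun t => if t ≤ w₁.length then rho₁ t else rho₂ (t - w₁.length), ?_, ?_, ?_⟩
    · simp
    · rw [List.length_append]
      dsimp only
      split_ifs with h
      · obtain hw : w₂.length = 0 := by omega
        rw [hw, h₀, add_zero]
      · rw [Nat.add_sub_cancel_left]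
    · intro k hk
      dsimp only
      rcases lt_or_ge k w₁.length with hlt | hge
      · rw [if_pos hlt.le, if_pos (by omega), List.getElem_append_left hlt]
        exact h₁ k hlt
      · obtain ⟨t, rfl⟩ := Nat.exists_eq_add_of_le hge
        have h := h₂ t (by rw [List.length_append] at hk; omega)
        rw [List.getElem_append_right (by omega),
          if_neg (show ¬ w₁.length + t + 1 ≤ w₁.length by omega)]
        simp only [add_assoc, Nat.add_sub_cancel_left]
        split_ifs with ht
        · -- the step from the end of the first chain
          obtain rfl : t = 0 := by omega
          rwa [h₀] at h
        · exact h

theorem isYamanouchiSymbol_cons {mu nu : YoungDiagram} {r : ℕ} {w : List ℕ} :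
    IsYamanouchiSymbol mu nu (r :: w) ↔
      ∃ rho, AddsBoxInRow mu rho r ∧ IsYamanouchiSymbol rho nu w := by
  rw [← List.singleton_append, isYamanouchiSymbol_append]
  simp only [isYamanouchiSymbol_singleton]

theorem IsYamanouchiSymbol.rowLen {mu nu : YoungDiagram} {w : List ℕ}
    (h : IsYamanouchiSymbol mu nu w) (i : ℕ) :
    nu.rowLen i = mu.rowLen i + w.count (i + 1) := by
  induction w generalizing mu with
  | nil => rw [isYamanouchiSymbol_nil.1 h, List.count_nil, add_zero]
  | cons r w ih =>
    obtain ⟨rho, h₁, h₂⟩ := isYamanouchiSymbol_cons.1 h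
    rw [ih h₂, addsBoxInRow_rowLen h₁, List.count_cons]
    simp only [beq_iff_eq, eq_comm (a := r)]
    omega

theorem IsYamanouchiSymbol.card {mu nu : YoungDiagram} {w : List ℕ}
    (h : IsYamanouchiSymbol mu nu w) : nu.card = mu.card + w.length := by
  induction w generalizing mu with
  | nil => rw [isYamanouchiSymbol_nil.1 h, List.length_nil, add_zero]
  | cons r w ih =>
    obtain ⟨rho, h₁, h₂⟩ := isYamanouchiSymbol_cons.1 h
    rw [ih h₂, addsBoxInRow_card h₁, List.length_cons]
    omega

theorem YoungDiagram.eq_of_rowLen {mu nu : YoungDiagram} (h : ∀ i, mu.rowLen i = nu.rowLen i) :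
    mu = nu := by
  ext ⟨i, j⟩
  rw [YoungDiagram.mem_cells, YoungDiagram.mem_cells, YoungDiagram.mem_iff_lt_rowLen,
    YoungDiagram.mem_iff_lt_rowLen, h]

/-- Adding a vertical strip from top to bottom passes through Young diagrams only. -/
theorem exists_isYamanouchiSymbol_of_pairwise {mu : YoungDiagram} {w : List ℕ}
    (hw : w.Pairwise (· < ·)) (hpos : ∀ r ∈ w, 0 < r)
    (hmu : Antitone fun i => mu.rowLen i + w.count (i + 1)) :
    ∃ nu, IsYamanouchiSymbol mu nu w := by
  induction w generalizing mu with
  | nil => exact ⟨mu, isYamanouchiSymbol_nil.2 rfl⟩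
  | cons r w ih =>
    rw [List.pairwise_cons] at hw
    obtain ⟨i, rfl⟩ : ∃ i, r = i + 1 :=
      Nat.exists_eq_add_one.2 (hpos r List.mem_cons_self)
    have hbox : ∃ sigma, AddsBoxInRow mu sigma (i + 1) := by
      refine exists_addsBoxInRow ?_
      rintro i' rfl
      have h₁ : mu.rowLen (i' + 1) + ((i' + 1 + 1) :: w).count (i' + 1 + 1) ≤
        mu.rowLen i' + ((i' + 1 + 1) :: w).count (i' + 1) := hmu (Nat.le_succ i')
      have h₂ : w.count (i' + 1) = 0 := List.count_eq_zero.2 fun hm => by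
        have := hw.1 _ hm
        omega
      rw [List.count_cons_self, List.count_cons_of_ne (by omega), h₂] at h₁
      omega
    obtain ⟨rho, hrho⟩ := hbox
    obtain ⟨nu, hnu⟩ := ih (mu := rho) hw.2 (fun r hr => hpos r (List.mem_cons_of_mem _ hr)) (by
      convert hmu using 2 with a
      rw [addsBoxInRow_rowLen hrho, List.count_cons]
      simp only [beq_iff_eq, eq_comm (a := i + 1)]
      omega)
    exact ⟨nu, isYamanouchiSymbol_cons.2 ⟨rho, hrho, hnu⟩⟩

theorem YoungDiagram.card_eq_sum_colLen (lam : YoungDiagram) :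
    lam.card = ∑ j ∈ Finset.range (lam.rowLen 0), lam.colLen j := by
  rw [YoungDiagram.card, Finset.card_eq_sum_card_fiberwise (f := Prod.snd)
    (t := Finset.range (lam.rowLen 0))]
  · exact Finset.sum_congr rfl fun j _ => (lam.colLen_eq_card).symm
  · rintro ⟨i, j⟩ hp
    have := lam.up_left_mem (Nat.zero_le i) le_rfl hp
    rw [YoungDiagram.mem_iff_lt_rowLen] at this
    simpa using this

/-! ### Column words and dominance -/

namespace ReverseTableau

variable {lam : YoungDiagram}

/-- The entries of column `j`, from bottom to top. -/
def colWord (T : ReverseTableau lam) (j : ℕ) : List ℕ :=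
  (List.range (lam.colLen j)).reverse.map fun i => T.entry i j

/-- The column word of the first `J` columns. -/
def wordBefore (T : ReverseTableau lam) (J : ℕ) : List ℕ :=
  (List.range J).flatMap T.colWord

theorem columnWord_eq (T : ReverseTableau lam) : T.columnWord = T.wordBefore (lam.rowLen 0) := rfl

theorem wordBefore_succ (T : ReverseTableau lam) (J : ℕ) :
    T.wordBefore (J + 1) = T.wordBefore J ++ T.colWord J := by
  simp [wordBefore, List.range_succ]

theorem length_columnWord (T : ReverseTableau lam) : T.columnWord.length = lam.card := by
  rw [columnWord_eq, YoungDiagram.card_eq_sum_colLen]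
  induction lam.rowLen 0 with
  | zero => rfl
  | succ J ih =>
    rw [wordBefore_succ, List.length_append, ih, Finset.sum_range_succ]
    simp [colWord]

theorem entry_add_le (T : ReverseTableau lam) {i j : ℕ} (d : ℕ) (h : (i + d, j) ∈ lam) :
    T.entry (i + d) j + d ≤ T.entry i j := by
  induction d with
  | zero => exact le_rfl
  | succ d ih =>
    have h₁ := ih (lam.up_left_mem (by omega) le_rfl h)
    have h₂ := T.col_strict (show i + d < i + (d + 1) by omega) h
    omega

theorem pairwise_colWord (T : ReverseTableau lam) (j : ℕ) : (T.colWord j).Pairwise (· < ·) := by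
  rw [colWord, List.pairwise_map, List.pairwise_reverse]
  refine List.Pairwise.imp_of_mem ?_ List.pairwise_lt_range
  intro a b _ hb hab
  exact T.col_strict hab (YoungDiagram.mem_iff_lt_colLen.2 (List.mem_range.1 hb))

theorem pos_of_mem_colWord (T : ReverseTableau lam) {j r : ℕ} (h : r ∈ T.colWord j) : 0 < r := by
  simp only [colWord, List.mem_map, List.mem_reverse, List.mem_range] at h
  obtain ⟨i, hi, rfl⟩ := h
  exact T.pos (YoungDiagram.mem_iff_lt_colLen.2 hi)

theorem weightBefore_zero (T : ReverseTableau lam) (m : ℕ) : T.weightBefore 0 m = 0 := by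
  simp [weightBefore]

theorem count_colWord (T : ReverseTableau lam) (j r : ℕ) :
    (T.colWord j).count r =
      ((Finset.range (lam.colLen j)).filter fun i => T.entry i j = r).card := by
  rw [← Nat.count_eq_card_filter_range, Nat.count, colWord, List.count, List.countP_map,
    List.countP_reverse]
  rfl

theorem weightBefore_succ (T : ReverseTableau lam) (J m : ℕ) :
    T.weightBefore (J + 1) m = T.weightBefore J m + (T.colWord J).count (m + 1) := by
  rw [count_colWord, weightBefore, weightBefore,
    ← Finset.card_filter_add_card_filter_not (s := lam.cells.filter fun p =>
      p.2 < J + 1 ∧ T.entry p.1 p.2 = m + 1) (fun p => p.2 < J), Finset.filter_filter,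
    Finset.filter_filter]
  congr 1
  · congr 1
    exact Finset.filter_congr fun p _ => by omega
  · rw [← Finset.card_map (Function.Embedding.sectL ℕ J)]
    congr 1
    ext ⟨i, j⟩
    simp only [Finset.mem_filter, YoungDiagram.mem_cells, Finset.mem_map, Finset.mem_range,
      Function.Embedding.sectL_apply, Prod.mk.injEq]
    constructor
    · rintro ⟨hm, ⟨h₁, h₂⟩, h₃⟩
      obtain rfl : j = J := by omega
      exact ⟨i, ⟨YoungDiagram.mem_iff_lt_colLen.1 hm, h₂⟩, rfl, rfl⟩
    · rintro ⟨i, ⟨h₁, h₂⟩, rfl, rfl⟩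
      exact ⟨YoungDiagram.mem_iff_lt_colLen.2 h₁, ⟨by omega, h₂⟩, by omega⟩

theorem count_wordBefore (T : ReverseTableau lam) (J m : ℕ) :
    (T.wordBefore J).count (m + 1) = T.weightBefore J m := by
  induction J with
  | zero => rw [weightBefore_zero]; rfl
  | succ J ih => rw [wordBefore_succ, List.count_append, ih, weightBefore_succ]

theorem weightBefore_of_le (T : ReverseTableau lam) {J : ℕ} (h : lam.rowLen 0 ≤ J) (m : ℕ) :
    T.weightBefore J m = T.weight m := by
  unfold weightBefore weight
  congr 1
  refine Finset.filter_congr fun p hp => and_iff_right ?_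
  have := lam.up_left_mem (Nat.zero_le p.1) le_rfl hp
  rw [YoungDiagram.mem_iff_lt_rowLen] at this
  omega

/-- The row lengths of `mu`, increased by the content of the first `J` columns, weakly decrease. -/
def Dominant (T : ReverseTableau lam) (mu : YoungDiagram) (J : ℕ) : Prop :=
  Antitone fun i => mu.rowLen i + T.weightBefore J i

theorem dominant_iff (T : ReverseTableau lam) (mu : YoungDiagram) (J : ℕ) :
    T.Dominant mu J ↔ ∀ i, mu.rowLen (i + 1) + T.weightBefore J (i + 1) ≤
      mu.rowLen i + T.weightBefore J i :=
  ⟨fun h i => h (Nat.le_add_right i 1), fun h => antitone_nat_of_succ_le h⟩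

theorem exists_isYamanouchiSymbol_columnWord {T : ReverseTableau lam} {mu : YoungDiagram}
    (h : ∀ J, T.Dominant mu J) : ∃ nu, IsYamanouchiSymbol mu nu T.columnWord := by
  rw [columnWord_eq]
  induction lam.rowLen 0 with
  | zero => exact ⟨mu, isYamanouchiSymbol_nil.2 rfl⟩
  | succ J ih =>
    obtain ⟨rho, hrho⟩ := ih
    obtain ⟨nu, hnu⟩ := exists_isYamanouchiSymbol_of_pairwise (mu := rho) (T.pairwise_colWord J)
      (fun r hr => T.pos_of_mem_colWord hr) (by
        have hJ := h (J + 1)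
        simp only [Dominant, weightBefore_succ, ← add_assoc] at hJ
        simpa only [hrho.rowLen, count_wordBefore] using hJ)
    exact ⟨nu, by rw [wordBefore_succ]; exact isYamanouchiSymbol_append.2 ⟨rho, hrho, hnu⟩⟩

theorem rowLen_of_isYamanouchiSymbol {T : ReverseTableau lam} {mu nu : YoungDiagram}
    (h : IsYamanouchiSymbol mu nu T.columnWord) (i : ℕ) :
    nu.rowLen i = mu.rowLen i + T.weight i := by
  rw [h.rowLen, columnWord_eq, count_wordBefore, weightBefore_of_le T le_rfl]

theorem wordBefore_add (T : ReverseTableau lam) (J d : ℕ) :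
    ∃ w, T.wordBefore (J + d) = T.wordBefore J ++ w := by
  induction d with
  | zero => exact ⟨[], (List.append_nil _).symm⟩
  | succ d ih =>
    obtain ⟨w, hw⟩ := ih
    exact ⟨w ++ T.colWord (J + d), by
      rw [← add_assoc, wordBefore_succ, hw, List.append_assoc]⟩

theorem dominant_of_isYamanouchiSymbol {T : ReverseTableau lam} {mu nu : YoungDiagram}
    (h : IsYamanouchiSymbol mu nu T.columnWord) (J : ℕ) : T.Dominant mu J := by
  rcases le_total J (lam.rowLen 0) with hJ | hJ
  · obtain ⟨d, hd⟩ := Nat.exists_eq_add_of_le hJ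
    obtain ⟨w, hw⟩ := T.wordBefore_add J d
    rw [columnWord_eq, hd, hw] at h
    obtain ⟨rho, hrho, -⟩ := isYamanouchiSymbol_append.1 h
    intro a b hab
    have := rho.rowLen_anti a b hab
    rwa [hrho.rowLen, hrho.rowLen, count_wordBefore, count_wordBefore] at this
  · intro a b hab
    have := nu.rowLen_anti a b hab
    rw [rowLen_of_isYamanouchiSymbol h, rowLen_of_isYamanouchiSymbol h] at this
    simpa only [weightBefore_of_le T hJ] using this

theorem isYamanouchiSymbol_columnWord_iff {T : ReverseTableau lam} {mu nu : YoungDiagram} :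
    IsYamanouchiSymbol mu nu T.columnWord ↔
      (∀ J, T.Dominant mu J) ∧ ∀ i, nu.rowLen i = mu.rowLen i + T.weight i := by
  refine ⟨fun h => ⟨dominant_of_isYamanouchiSymbol h, rowLen_of_isYamanouchiSymbol h⟩,
    fun ⟨h₁, h₂⟩ => ?_⟩
  obtain ⟨nu', h⟩ := exists_isYamanouchiSymbol_columnWord h₁
  rwa [YoungDiagram.eq_of_rowLen fun i => (h₂ i).trans (rowLen_of_isYamanouchiSymbol h i).symm]

theorem weightBefore_lt_succ (T : ReverseTableau lam) {i j r : ℕ} (h : T.entry i j = r + 1) :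
    T.weightBefore j r < T.weightBefore (j + 1) r := by
  rw [weightBefore_succ, count_colWord]
  refine Nat.lt_add_of_pos_right (Finset.card_pos.2 ⟨i, Finset.mem_filter.2 ⟨?_, h⟩⟩)
  rw [Finset.mem_range, ← YoungDiagram.mem_iff_lt_colLen]
  exact T.mem_of_entry_pos (by omega)

/-! ### Boundedness -/

/-- When the first `J + 1` columns have been read, the row numbered by the top entry of
column `J` has more than `J` boxes: its predecessors in the first row are at least as large, so
that each column adds a box to a row whose length is at least the number of columns read before. -/
theorem lt_rowLen_add_weightBefore {T : ReverseTableau lam} {mu : YoungDiagram}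
    (h : ∀ J, T.Dominant mu J) {J r : ℕ} (hr : T.entry 0 J = r + 1) :
    J < mu.rowLen r + T.weightBefore (J + 1) r := by
  induction J generalizing r with
  | zero =>
    have := T.weightBefore_lt_succ hr
    omega
  | succ J ih =>
    have h₁ := T.antitone_entry 0 (Nat.le_add_right J 1)
    obtain ⟨s, hs⟩ := Nat.exists_eq_add_of_lt (show 0 < T.entry 0 J by omega)
    have h₂ := ih (r := s) (by omega)
    have h₃ : mu.rowLen s + T.weightBefore (J + 1) s ≤ mu.rowLen r + T.weightBefore (J + 1) r :=
      h (J + 1) (by omega)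
    have h₄ := T.weightBefore_lt_succ hr
    omega

theorem entry_zero_le_colLen {T : ReverseTableau lam} {mu nu : YoungDiagram}
    (h : IsYamanouchiSymbol mu nu T.columnWord) (j : ℕ) : T.entry 0 j ≤ nu.colLen j := by
  rcases Nat.eq_zero_or_pos (T.entry 0 j) with h₀ | h₀
  · omega
  · obtain ⟨r, hr⟩ := Nat.exists_eq_add_of_lt h₀
    have h₁ := lt_rowLen_add_weightBefore (dominant_of_isYamanouchiSymbol h) (J := j) (r := r)
      (by omega)
    have h₂ := T.weightBefore_add_weightFrom (j + 1) r
    have h₃ : (r, j) ∈ nu := by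
      rw [YoungDiagram.mem_iff_lt_rowLen, rowLen_of_isYamanouchiSymbol h]
      omega
    rw [YoungDiagram.mem_iff_lt_colLen] at h₃
    omega

theorem isBounded_of_isYamanouchiSymbol {T : ReverseTableau lam} {mu nu : YoungDiagram}
    (h : IsYamanouchiSymbol mu nu T.columnWord) : T.IsBounded nu :=
  fun j _ => entry_zero_le_colLen h j

theorem entry_le_colLen {T : ReverseTableau lam} {mu nu : YoungDiagram}
    (h : IsYamanouchiSymbol mu nu T.columnWord) (i j : ℕ) : T.entry i j ≤ nu.colLen 0 := by
  by_cases hm : (i, j) ∈ lam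
  · have h₁ := T.entry_add_le (i := 0) (j := j) i (by rwa [zero_add])
    rw [zero_add] at h₁
    have h₂ := entry_zero_le_colLen h j
    have h₃ := nu.colLen_anti 0 j (Nat.zero_le j)
    omega
  · rw [T.zeros hm]
    exact Nat.zero_le _

/-! ### Chains from the empty diagram -/

/-- The reverse tableau with the entries `1, 2, …` from bottom to top in each column. -/
def standardFilling (lam : YoungDiagram) : ReverseTableau lam where
  entry i j := lam.colLen j - i
  pos h := by
    rw [YoungDiagram.mem_iff_lt_colLen] at h
    omega
  row_weak {i j₁ j₂} h _ := by
    have := lam.colLen_anti j₁ j₂ h.le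
    omega
  col_strict h hm := by
    rw [YoungDiagram.mem_iff_lt_colLen] at hm
    omega
  zeros h := by
    rw [YoungDiagram.mem_iff_lt_colLen] at h
    omega

@[simp]
theorem standardFilling_entry (i j : ℕ) :
    (standardFilling lam).entry i j = lam.colLen j - i := rfl

theorem colLen_sub_le_entry (T : ReverseTableau lam) (i j : ℕ) :
    lam.colLen j - i ≤ T.entry i j := by
  rcases le_or_gt (lam.colLen j) i with h | h
  · omega
  · have hm : (i + (lam.colLen j - 1 - i), j) ∈ lam := by
      rw [YoungDiagram.mem_iff_lt_colLen]
      omega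
    have h₁ := T.entry_add_le _ hm
    have h₂ := T.pos hm
    omega

theorem eq_standardFilling {T : ReverseTableau lam} (h : ∀ j, T.entry 0 j ≤ lam.colLen j) :
    T = standardFilling lam := by
  refine ext_entry fun i j => le_antisymm ?_ (T.colLen_sub_le_entry i j)
  by_cases hm : (i, j) ∈ lam
  · have h₁ := T.entry_add_le (i := 0) (j := j) i (by rwa [zero_add])
    rw [zero_add] at h₁
    have h₂ := h j
    rw [standardFilling_entry]
    omega
  · rw [T.zeros hm]
    exact Nat.zero_le _

theorem dominant_standardFilling (mu : YoungDiagram) (J : ℕ) :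
    (standardFilling lam).Dominant mu J := by
  induction J with
  | zero =>
    intro a b hab
    simpa only [weightBefore_zero, add_zero] using mu.rowLen_anti a b hab
  | succ J ih =>
    have hc : ∀ m, ((standardFilling lam).colWord J).count (m + 1) =
        if m < lam.colLen J then 1 else 0 := by
      intro m
      rw [count_colWord]
      split_ifs with hm
      · rw [Finset.card_eq_one]
        refine ⟨lam.colLen J - (m + 1), ?_⟩
        ext i
        rw [Finset.mem_filter, Finset.mem_range, Finset.mem_singleton, standardFilling_entry]
        omega
      · rw [Finset.card_eq_zero, Finset.filter_eq_empty_iff]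
        intro i _
        rw [standardFilling_entry]
        omega
    intro a b hab
    have h₁ : mu.rowLen b + _ ≤ mu.rowLen a + _ := ih hab
    simp only [weightBefore_succ, hc]
    split_ifs <;> omega

/-- Among the reverse tableaux of shape `lam`, only the standard filling has a Yamanouchi symbol
of a chain from the empty diagram as its column word; the chain ends in `lam`. For the diagram
`nu` at its end satisfies `lam'_j ≤ T(1, j) ≤ nu'_j`, and it has as many boxes as `lam`. -/
theorem isYamanouchiSymbol_bot_iff {T : ReverseTableau lam} {nu : YoungDiagram} :
    IsYamanouchiSymbol ⊥ nu T.columnWord ↔ nu = lam ∧ T = standardFilling lam := by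
  have key : ∀ {T : ReverseTableau lam} {nu : YoungDiagram},
      IsYamanouchiSymbol ⊥ nu T.columnWord → nu = lam := by
    intro T nu h
    have hc := h.card
    rw [length_columnWord, show (⊥ : YoungDiagram).card = 0 from rfl, zero_add] at hc
    refine (YoungDiagram.ext (Finset.eq_of_subset_of_card_le ?_ hc.le)).symm
    rintro ⟨i, j⟩ hm
    rw [YoungDiagram.mem_cells, YoungDiagram.mem_iff_lt_colLen] at hm ⊢
    have h₁ := T.colLen_sub_le_entry 0 j
    have h₂ := entry_zero_le_colLen h j
    omega
  constructor
  · intro h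
    obtain rfl := key h
    exact ⟨rfl, eq_standardFilling (entry_zero_le_colLen h)⟩
  · rintro ⟨rfl, rfl⟩
    obtain ⟨nu', h⟩ := exists_isYamanouchiSymbol_columnWord
      (T := standardFilling nu) (mu := ⊥) (dominant_standardFilling ⊥)
    rwa [key h] at h

end ReverseTableau

/-! ### Alternants -/

section Alternant

variable {n : ℕ}

/-- The monomial `∏ x_m ^ (a m)`. -/
noncomputable def expMonomial (a : Fin n → ℕ) : MvPolynomial (Fin n) ℤ :=
  MvPolynomial.monomial (Finsupp.equivFunOnFinite.symm a) 1

theorem expMonomial_add (a b : Fin n → ℕ) :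
    expMonomial (a + b) = expMonomial a * expMonomial b := by
  rw [expMonomial, expMonomial, expMonomial, MvPolynomial.monomial_mul, one_mul]
  congr 2
  ext m
  rfl

theorem rename_expMonomial (e : Perm (Fin n)) (a : Fin n → ℕ) :
    MvPolynomial.rename e (expMonomial a) = expMonomial (a ∘ e.symm) := by
  rw [expMonomial, expMonomial, MvPolynomial.rename_monomial]
  congr 2
  ext m
  obtain ⟨m, rfl⟩ := e.surjective m
  rw [Finsupp.mapDomain_apply e.injective]
  simp

theorem coeff_expMonomial (a b : Fin n → ℕ) :
    MvPolynomial.coeff (Finsupp.equivFunOnFinite.symm b) (expMonomial a) =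
      if a = b then 1 else 0 := by
  rw [expMonomial, MvPolynomial.coeff_monomial]
  simp only [EmbeddingLike.apply_eq_iff_eq]

theorem prod_X_eq_expMonomial {ι : Type*} [Fintype ι] (f : ι → Fin n) :
    ∏ p, (MvPolynomial.X (f p) : MvPolynomial (Fin n) ℤ) =
      expMonomial fun m => (Finset.univ.filter fun p => f p = m).card := by
  rw [expMonomial, MvPolynomial.monomial_eq, map_one, one_mul, Finsupp.prod_fintype _ _ (by simp),
    ← Finset.prod_fiberwise Finset.univ f]
  refine Finset.prod_congr rfl fun m _ => ?_
  rw [Finset.prod_congr rfl fun p hp => by rw [(Finset.mem_filter.1 hp).2], Finset.prod_const]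
  rfl

/-- The alternant `∑_σ sgn(σ) x ^ (a ∘ σ)`. -/
noncomputable def alternant (a : Fin n → ℕ) : MvPolynomial (Fin n) ℤ :=
  ∑ e : Perm (Fin n), (Perm.sign e : ℤ) • expMonomial (a ∘ e)

theorem alternant_comp (a : Fin n → ℕ) (t : Perm (Fin n)) :
    alternant (a ∘ t) = (Perm.sign t : ℤ) • alternant a := by
  rw [alternant, alternant, Finset.smul_sum]
  refine Fintype.sum_equiv (Equiv.mulLeft t) _ _ fun e => ?_
  rw [Equiv.coe_mulLeft, Perm.sign_mul, smul_smul, Units.val_mul, ← mul_assoc, ← Units.val_mul,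
    Int.units_mul_self, Units.val_one, one_mul, Perm.coe_mul, Function.comp_assoc]

theorem alternant_comp_swap (a : Fin n → ℕ) {i j : Fin n} (h : i ≠ j) :
    alternant (a ∘ swap i j) = -alternant a := by
  rw [alternant_comp, Perm.sign_swap h]
  simp

theorem alternant_mul_sum {ι : Type*} [Fintype ι] (w : ι → Fin n → ℕ)
    (h : (∑ t, expMonomial (w t)).IsSymmetric) (a : Fin n → ℕ) :
    alternant a * ∑ t, expMonomial (w t) = ∑ t, alternant (a + w t) := by
  simp only [alternant]
  rw [Finset.sum_comm, Finset.sum_mul]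
  refine Finset.sum_congr rfl fun e _ => ?_
  rw [← Finset.smul_sum, smul_mul_assoc]
  congr 1
  rw [← h e.symm, map_sum, Finset.mul_sum]
  refine Finset.sum_congr rfl fun t _ => ?_
  rw [rename_expMonomial, ← expMonomial_add]
  rfl

theorem coeff_alternant {a b : Fin n → ℕ} (ha : StrictAnti a) (hb : StrictAnti b) :
    MvPolynomial.coeff (Finsupp.equivFunOnFinite.symm b) (alternant a) =
      if a = b then 1 else 0 := by
  have key : ∀ e : Perm (Fin n), a ∘ e = b → e = 1 := by
    intro e h
    have he : StrictMono e := fun i j hij => by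
      rw [← ha.lt_iff_gt, ← Function.comp_apply (f := a), ← Function.comp_apply (f := a), h]
      exact hb hij
    have : Subsingleton (Fin n ≃o Fin n) := inferInstance
    have h₁ := Subsingleton.elim (he.orderIsoOfSurjective e e.surjective) (OrderIso.refl _)
    ext i
    exact congrArg Fin.val (congrArg (fun f : Fin n ≃o Fin n => f i) h₁)
  simp only [alternant, MvPolynomial.coeff_sum, MvPolynomial.coeff_smul, coeff_expMonomial]
  rw [Finset.sum_eq_single 1 (fun e _ hne => by
    rw [if_neg fun h => hne (key e h), smul_zero]) fun h => absurd (Finset.mem_univ _) h]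
  simp

/-- The row lengths of `nu`, increased by the staircase `n - 1, …, 1, 0`. -/
def shiftedRowLen (n : ℕ) (nu : YoungDiagram) (m : Fin n) : ℕ := nu.rowLen m + (n - 1 - m)

theorem strictAnti_shiftedRowLen (nu : YoungDiagram) : StrictAnti (shiftedRowLen n nu) := by
  intro i j h
  have h₁ := nu.rowLen_anti i j h.le
  have h₂ := j.isLt
  have h₃ : (i : ℕ) < j := h
  simp only [shiftedRowLen]
  omega

theorem YoungDiagram.rowLen_eq_zero {nu : YoungDiagram} {i : ℕ} (h : nu.colLen 0 ≤ i) :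
    nu.rowLen i = 0 := by
  by_contra hne
  have : (i, 0) ∈ nu := YoungDiagram.mem_iff_lt_rowLen.2 (Nat.pos_of_ne_zero hne)
  rw [YoungDiagram.mem_iff_lt_colLen] at this
  omega

theorem YoungDiagram.colLen_le_of_rowLen_eq_zero {nu : YoungDiagram} {i : ℕ}
    (h : nu.rowLen i = 0) : nu.colLen 0 ≤ i := by
  by_contra! hlt
  rw [← YoungDiagram.mem_iff_lt_colLen, YoungDiagram.mem_iff_lt_rowLen, h] at hlt
  exact hlt.false

theorem shiftedRowLen_inj {nu nu' : YoungDiagram} (h : nu.colLen 0 ≤ n) (h' : nu'.colLen 0 ≤ n) :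
    shiftedRowLen n nu = shiftedRowLen n nu' ↔ nu = nu' := by
  refine ⟨fun he => YoungDiagram.eq_of_rowLen fun i => ?_, fun he => he ▸ rfl⟩
  rcases lt_or_ge i n with hi | hi
  · have := congrFun he ⟨i, hi⟩
    simpa only [shiftedRowLen, Nat.add_right_cancel_iff] using this
  · rw [YoungDiagram.rowLen_eq_zero (h.trans hi), YoungDiagram.rowLen_eq_zero (h'.trans hi)]

theorem alternant_shiftedRowLen_ne_zero (nu : YoungDiagram) :
    alternant (shiftedRowLen n nu) ≠ 0 := by
  intro h
  have := coeff_alternant (strictAnti_shiftedRowLen (n := n) nu) (strictAnti_shiftedRowLen nu)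
  rw [h, if_pos rfl, MvPolynomial.coeff_zero] at this
  exact zero_ne_one this

end Alternant

/-! ### Symmetry of Schur polynomials -/

/-- The reverse tableaux of shape `lam` with entries at most `n`. -/
abbrev BoundedReverseTableau (n : ℕ) (lam : YoungDiagram) : Type :=
  {T : ReverseTableau lam // ∀ i j, T.entry i j ≤ n}

/-- Subtracting the entries of a reverse tableau from `n` gives a semistandard tableau. -/
def boundedReverseTableauEquiv (n : ℕ) (lam : YoungDiagram) :
    BoundedReverseTableau n lam ≃ BoundedSSYT n lam where
  toFun T := ⟨{
    entry := fun i j => if (i, j) ∈ lam then n - T.1.entry i j else 0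
    row_weak' := by
      intro i j₁ j₂ h hm
      have := T.1.row_weak h hm
      rw [if_pos hm, if_pos (lam.up_left_mem le_rfl h.le hm)]
      omega
    col_strict' := by
      intro i₁ i₂ j h hm
      have h₁ := T.1.col_strict h hm
      have h₂ := T.2 i₁ j
      rw [if_pos hm, if_pos (lam.up_left_mem h.le le_rfl hm)]
      omega
    zeros' := fun h => if_neg h }, by
      rintro ⟨i, j⟩ hp
      have h₁ := T.1.pos hp
      have h₂ := T.2 i j
      change (if (i, j) ∈ lam then n - T.1.entry i j else 0) < n
      split_ifs <;> omega⟩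
  invFun S := ⟨{
    entry := fun i j => if (i, j) ∈ lam then n - S.1 i j else 0
    pos := by
      intro i j hm
      have : S.1 i j < n := S.2 (i, j) hm
      rw [if_pos hm]
      omega
    row_weak := by
      intro i j₁ j₂ h hm
      have := S.1.row_weak h hm
      rw [if_pos hm, if_pos (lam.up_left_mem le_rfl h.le hm)]
      omega
    col_strict := by
      intro i₁ i₂ j h hm
      have h₁ := S.1.col_strict h hm
      have h₂ : S.1 i₂ j < n := S.2 (i₂, j) hm
      rw [if_pos hm, if_pos (lam.up_left_mem h.le le_rfl hm)]
      omega
    zeros := fun h => if_neg h }, by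
      intro i j
      dsimp only
      split_ifs <;> omega⟩
  left_inv T := by
    refine Subtype.ext (ReverseTableau.ext_entry fun i j => ?_)
    change (if (i, j) ∈ lam then n - (if (i, j) ∈ lam then n - T.1.entry i j else 0) else 0) = _
    have h₁ := T.2 i j
    split_ifs with hm
    · omega
    · exact (T.1.zeros hm).symm
  right_inv S := by
    refine Subtype.ext (SemistandardYoungTableau.ext fun i j => ?_)
    change (if (i, j) ∈ lam then n - (if (i, j) ∈ lam then n - S.1 i j else 0) else 0) = _
    split_ifs with hm
    · have : S.1 i j < n := S.2 (i, j) hm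
      omega
    · exact (S.1.zeros hm).symm

instance (n : ℕ) (lam : YoungDiagram) : Finite (BoundedReverseTableau n lam) :=
  Finite.of_equiv _ (boundedReverseTableauEquiv n lam).symm

noncomputable instance (n : ℕ) (lam : YoungDiagram) : Fintype (BoundedReverseTableau n lam) :=
  Fintype.ofFinite _

namespace ReverseTableau

variable {lam : YoungDiagram}

theorem weightFrom_zero (T : ReverseTableau lam) (m : ℕ) : T.weightFrom 0 m = T.weight m := by
  rw [← T.weightBefore_add_weightFrom 0 m, weightBefore_zero, zero_add]

theorem separated_zero (T : ReverseTableau lam) (k : ℕ) : T.Separated 0 k :=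
  fun _ j h => absurd h (Nat.succ_ne_zero j)

theorem weightFrom_toggle {T : ReverseTableau lam} {J k : ℕ} (hT : T.Separated J k) (m : ℕ) :
    (T.toggle J k hT).weightFrom J m = T.weightFrom J (swap k (k + 1) m) := by
  rw [swap_apply_def]
  split_ifs with h₁ h₂
  · rw [h₁, weightFrom_toggle_left]
  · rw [h₂, weightFrom_toggle_right]
  · exact weightFrom_toggle_of_ne hT h₁ h₂

theorem toggle_entry_le {T : ReverseTableau lam} {J k n : ℕ} (hT : T.Separated J k)
    (hk : k + 2 ≤ n) (h : ∀ i j, T.entry i j ≤ n) (i j : ℕ) :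
    (T.toggle J k hT).entry i j ≤ n := by
  have h₁ := T.toggleEntry_cases J k i j
  have h₂ := h i j
  rw [toggle_entry]
  omega

end ReverseTableau

theorem swap_fin_val {n k : ℕ} (hk : k + 1 < n) (m : Fin n) :
    ((swap (⟨k, by omega⟩ : Fin n) ⟨k + 1, hk⟩ m : Fin n) : ℕ) = swap k (k + 1) (m : ℕ) := by
  simp only [swap_apply_def, Fin.ext_iff]
  split_ifs <;> rfl

/-- The exponents of the monomial `∏_{p ∈ lam} x_{T(p) - 1}`. -/
def BoundedReverseTableau.weight {n : ℕ} {lam : YoungDiagram} (T : BoundedReverseTableau n lam)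
    (m : Fin n) : ℕ := T.1.weight m

/-- The generating function of the reverse tableaux with bounded entries is symmetric, by the
Bender–Knuth involutions. -/
theorem isSymmetric_sum_weight (n : ℕ) (lam : YoungDiagram) :
    (∑ T : BoundedReverseTableau n lam, expMonomial T.weight).IsSymmetric := by
  rcases n with _ | n
  · intro e
    rw [Subsingleton.elim e 1, Perm.coe_one, MvPolynomial.rename_id, AlgHom.id_apply]
  intro e
  have he : e ∈ Submonoid.closure (Set.range fun i : Fin n => swap i.castSucc i.succ) := by
    rw [Perm.mclosure_swap_castSucc_succ]
    trivial
  induction he using Submonoid.closure_induction with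
  | mem e he =>
    obtain ⟨⟨k, hk⟩, rfl⟩ := he
    rw [map_sum]
    refine Finset.sum_nbij' (fun T => ⟨T.1.toggle 0 k (T.1.separated_zero k),
      ReverseTableau.toggle_entry_le _ (by omega) T.2⟩) (fun T => ⟨T.1.toggle 0 k
        (T.1.separated_zero k), ReverseTableau.toggle_entry_le _ (by omega) T.2⟩)
      (fun _ _ => Finset.mem_univ _) (fun _ _ => Finset.mem_univ _)
      (fun T _ => Subtype.ext (ReverseTableau.toggle_toggle (T.1.separated_zero k)))
      (fun T _ => Subtype.ext (ReverseTableau.toggle_toggle (T.1.separated_zero k))) fun T _ => ?_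
    rw [rename_expMonomial, symm_swap]
    congr 1
    funext m
    simp only [BoundedReverseTableau.weight, Function.comp_apply]
    rw [← ReverseTableau.weightFrom_zero (T.1.toggle _ _ _), ReverseTableau.weightFrom_toggle,
      ReverseTableau.weightFrom_zero, ← swap_fin_val (n := n + 1) (by omega)]
    rfl
  | one => rw [Perm.coe_one, MvPolynomial.rename_id, AlgHom.id_apply]
  | mul e e' _ _ h h' =>
    rw [Perm.coe_mul, ← MvPolynomial.rename_rename, h', h]

theorem schurPoly_eq_sum_weight (n : ℕ) (lam : YoungDiagram) :
    schurPoly n lam = ∑ T : BoundedReverseTableau n lam, expMonomial T.weight := by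
  rw [← isSymmetric_sum_weight n lam Fin.revPerm, map_sum, schurPoly]
  refine (Fintype.sum_equiv (boundedReverseTableauEquiv n lam) _ _ fun T => ?_).symm
  rw [prod_X_eq_expMonomial, rename_expMonomial]
  congr 1
  funext m
  simp only [BoundedReverseTableau.weight, ReverseTableau.weight, Function.comp_apply]
  rw [← Finset.card_map (Function.Embedding.subtype _)]
  congr 1
  ext ⟨i, j⟩
  simp only [Finset.mem_filter, Finset.mem_map, Finset.mem_univ, true_and,
    Function.Embedding.subtype_apply, Subtype.exists, exists_and_right, exists_eq_right,
    YoungDiagram.mem_cells]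
  have key : ∀ hm : (i, j) ∈ lam, T.1.entry i j = ((Fin.revPerm.symm m : Fin n) : ℕ) + 1 ↔
      (boundedReverseTableauEquiv n lam T).1 i j = (m : ℕ) := by
    intro hm
    have h₁ : (boundedReverseTableauEquiv n lam T).1 i j = n - T.1.entry i j := if_pos hm
    have h₂ := T.2 i j
    have h₃ := T.1.pos hm
    have h₄ := m.isLt
    rw [h₁, Fin.revPerm_symm, Fin.revPerm_apply, Fin.val_rev]
    omega
  constructor
  · rintro ⟨hm, h⟩
    exact ⟨hm, Fin.ext ((key hm).1 h)⟩
  · rintro ⟨hm, h⟩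
    exact ⟨hm, (key hm).2 (congrArg Fin.val h)⟩

/-! ### Cancellation of non-dominant tableaux -/

namespace ReverseTableau

variable {lam : YoungDiagram}

/-- Reading the columns of `T` from left to right, dominance fails for the first time after
`J` columns, and the first failure there is in the rows `k` and `k + 1`. -/
def FirstFailure (T : ReverseTableau lam) (mu : YoungDiagram) (J k : ℕ) : Prop :=
  (∀ J' < J, T.Dominant mu J') ∧
    (∀ k' < k, mu.rowLen (k' + 1) + T.weightBefore J (k' + 1) ≤
      mu.rowLen k' + T.weightBefore J k') ∧
    mu.rowLen k + T.weightBefore J k < mu.rowLen (k + 1) + T.weightBefore J (k + 1)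

theorem exists_firstFailure {T : ReverseTableau lam} {mu : YoungDiagram}
    (h : ¬ ∀ J, T.Dominant mu J) : ∃ J k, T.FirstFailure mu J k := by
  classical
  push Not at h
  have h₁ := Nat.find_spec h
  rw [dominant_iff] at h₁
  push Not at h₁
  exact ⟨Nat.find h, Nat.find h₁, fun J' hJ' => not_not.1 (Nat.find_min h hJ'),
    fun k' hk' => not_lt.1 (Nat.find_min h₁ hk'), Nat.find_spec h₁⟩

variable {T : ReverseTableau lam} {mu : YoungDiagram} {J k : ℕ}

theorem FirstFailure.not_dominant (h : T.FirstFailure mu J k) : ¬ T.Dominant mu J :=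
  fun hd => absurd ((T.dominant_iff mu J).1 hd k) (not_le.2 h.2.2)

theorem FirstFailure.unique {J' k' : ℕ} (h : T.FirstFailure mu J k)
    (h' : T.FirstFailure mu J' k') : J = J' ∧ k = k' := by
  obtain rfl : J = J' := by
    rcases lt_trichotomy J J' with hlt | rfl | hlt
    · exact absurd (h'.1 J hlt) h.not_dominant
    · rfl
    · exact absurd (h.1 J' hlt) h'.not_dominant
  refine ⟨rfl, ?_⟩
  rcases lt_trichotomy k k' with hlt | rfl | hlt
  · exact absurd (h'.2.1 k hlt) (not_le.2 h.2.2)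
  · rfl
  · exact absurd (h.2.1 k' hlt) (not_le.2 h'.2.2)

theorem FirstFailure.toggle (h : T.FirstFailure mu J k) (hT : T.Separated J k) :
    (T.toggle J k hT).FirstFailure mu J k := by
  refine ⟨fun J' hJ' => ?_, ?_⟩
  · have := h.1 J' hJ'
    unfold Dominant at this ⊢
    simpa only [weightBefore_toggle hT hJ'.le] using this
  · simpa only [weightBefore_toggle hT le_rfl] using h.2

theorem count_colWord_le_one (T : ReverseTableau lam) (j r : ℕ) : (T.colWord j).count r ≤ 1 :=
  List.nodup_iff_count_le_one.1 ((T.pairwise_colWord j).imp fun h => h.ne) r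

/-- At the first failure the last column read contains `k + 2` but not `k + 1`, and the partial
sums for the rows `k` and `k + 1` differ by one. -/
theorem FirstFailure.separated (h : T.FirstFailure mu J k) :
    T.Separated J k ∧
      mu.rowLen k + T.weightBefore J k + 1 = mu.rowLen (k + 1) + T.weightBefore J (k + 1) := by
  have h₀ := h.2.2
  have hmu := mu.rowLen_anti k (k + 1) (by omega)
  rcases J with _ | J
  · rw [weightBefore_zero, weightBefore_zero] at h₀
    omega
  have h₁ := (T.dominant_iff mu J).1 (h.1 J (by omega)) k
  have h₂ := T.count_colWord_le_one J (k + 1 + 1)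
  have h₃ := T.weightBefore_succ J (k + 1)
  have h₄ := T.weightBefore_succ J k
  refine ⟨fun i j hj he => ?_, by omega⟩
  obtain rfl : j = J := by omega
  have := T.weightBefore_lt_succ he
  omega

theorem weight_eq_zero {n m : ℕ} (h : ∀ i j, T.entry i j ≤ n) (hm : n ≤ m) : T.weight m = 0 := by
  rw [weight, Finset.card_eq_zero, Finset.filter_eq_empty_iff]
  intro p _
  have := h p.1 p.2
  omega

theorem FirstFailure.lt {n : ℕ} (h : T.FirstFailure mu J k) (hmu : mu.colLen 0 ≤ n)
    (hT : ∀ i j, T.entry i j ≤ n) : k + 1 < n := by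
  by_contra! hk
  have h₁ := h.2.2
  have h₂ := weight_eq_zero hT hk
  have h₃ := T.weightBefore_add_weightFrom J (k + 1)
  rw [YoungDiagram.rowLen_eq_zero (hmu.trans hk)] at h₁
  omega

theorem FirstFailure.shiftedRowLen_add_weight_toggle {n : ℕ} (h : T.FirstFailure mu J k)
    (hk : k + 1 < n) (m : Fin n) :
    shiftedRowLen n mu m + (T.toggle J k h.separated.1).weight m =
      shiftedRowLen n mu (swap ⟨k, by omega⟩ ⟨k + 1, hk⟩ m) +
        T.weight (swap (⟨k, by omega⟩ : Fin n) ⟨k + 1, hk⟩ m : Fin n) := by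
  have h₁ := h.separated.2
  rw [← weightBefore_add_weightFrom _ J, ← weightBefore_add_weightFrom _ J, weightFrom_toggle,
    swap_fin_val, weightBefore_toggle _ le_rfl, ← add_assoc, ← add_assoc]
  congr 1
  simp only [shiftedRowLen, swap_fin_val]
  rw [swap_apply_def]
  split_ifs with h₂ h₃
  · rw [h₂]
    omega
  · rw [h₃]
    omega
  · rfl

end ReverseTableau

/-- Expanding `a_{mu + rho} s_lam` into alternants, the contributions of the tableaux that violate
dominance cancel. -/
theorem alternant_mul_schurPoly {n : ℕ} {mu : YoungDiagram} (hmu : mu.colLen 0 ≤ n)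
    (lam : YoungDiagram) [DecidablePred fun T : BoundedReverseTableau n lam =>
      ∀ J, T.1.Dominant mu J] :
    alternant (shiftedRowLen n mu) * schurPoly n lam =
      ∑ T : BoundedReverseTableau n lam with ∀ J, T.1.Dominant mu J,
        alternant (shiftedRowLen n mu + T.weight) := by
  rw [schurPoly_eq_sum_weight, alternant_mul_sum _ (isSymmetric_sum_weight n lam),
    ← Finset.sum_filter_add_sum_filter_not Finset.univ
      (fun T : BoundedReverseTableau n lam => ∀ J, T.1.Dominant mu J), add_eq_left]
  have hex : ∀ T ∈ Finset.univ.filter (fun T : BoundedReverseTableau n lam =>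
      ¬ ∀ J, T.1.Dominant mu J), ∃ J k, T.1.FirstFailure mu J k := fun T hT =>
    ReverseTableau.exists_firstFailure (Finset.mem_filter.1 hT).2
  choose J k hJk using hex
  have hneg : ∀ T hT, alternant (shiftedRowLen n mu + BoundedReverseTableau.weight
      (⟨T.1.toggle (J T hT) (k T hT) (hJk T hT).separated.1, ReverseTableau.toggle_entry_le _
        ((hJk T hT).lt hmu T.2) T.2⟩ : BoundedReverseTableau n lam)) =
      -alternant (shiftedRowLen n mu + T.weight) := by
    intro T hT
    have hk := (hJk T hT).lt hmu T.2
    rw [← alternant_comp_swap (i := ⟨k T hT, by omega⟩) (j := ⟨k T hT + 1, hk⟩) _ (by simp)]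
    congr 1
    funext m
    exact (hJk T hT).shiftedRowLen_add_weight_toggle hk m
  refine Finset.sum_involution (fun T hT => ⟨T.1.toggle (J T hT) (k T hT) (hJk T hT).separated.1,
      ReverseTableau.toggle_entry_le _ ((hJk T hT).lt hmu T.2) T.2⟩) ?_ ?_ ?_ ?_
  · intro T hT
    rw [hneg, add_neg_cancel]
  · intro T hT hne heq
    have := hneg T hT
    rw [heq] at this
    exact hne (self_eq_neg.1 this)
  · intro T hT
    exact Finset.mem_filter.2 ⟨Finset.mem_univ _, fun hd =>
      ((hJk T hT).toggle (hJk T hT).separated.1).not_dominant (hd _)⟩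
  · intro T hT
    refine Subtype.ext ?_
    -- the toggled tableau has its first failure at the same place
    have key : ∀ {U : ReverseTableau lam} {J' k' : ℕ} (hU : U.FirstFailure mu J' k'),
        U = T.1.toggle (J T hT) (k T hT) (hJk T hT).separated.1 →
        U.toggle J' k' hU.separated.1 = T.1 := by
      rintro U J' k' hU rfl
      obtain ⟨rfl, rfl⟩ := hU.unique ((hJk T hT).toggle (hJk T hT).separated.1)
      exact ReverseTableau.toggle_toggle _
    exact key (hJk _ _) rfl

/-! ### The bialternant formula and linear independence -/

theorem schurPoly_eq_zero {n : ℕ} {nu : YoungDiagram} (h : n < nu.colLen 0) :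
    schurPoly n nu = 0 := by
  rw [schurPoly_eq_sum_weight]
  refine Finset.sum_eq_zero fun T _ => ?_
  have h₁ := T.1.colLen_sub_le_entry 0 0
  have h₂ := T.2 0 0
  omega

/-- The bialternant formula for Schur polynomials. -/
theorem alternant_bot_mul_schurPoly {n : ℕ} {nu : YoungDiagram} (h : nu.colLen 0 ≤ n) :
    alternant (shiftedRowLen n ⊥) * schurPoly n nu = alternant (shiftedRowLen n nu) := by
  classical
  have hbot : (⊥ : YoungDiagram).colLen 0 ≤ n := by
    by_contra! hlt
    exact YoungDiagram.notMem_bot (0, 0)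
      (YoungDiagram.mem_iff_lt_colLen.2 (Nat.zero_lt_of_lt hlt))
  have hbd : ∀ i j, (ReverseTableau.standardFilling nu).entry i j ≤ n := fun i j => by
    have := nu.colLen_anti 0 j (Nat.zero_le j)
    rw [ReverseTableau.standardFilling_entry]
    omega
  have hw := (ReverseTableau.isYamanouchiSymbol_columnWord_iff.1
    (ReverseTableau.isYamanouchiSymbol_bot_iff.2 ⟨(rfl : nu = nu), rfl⟩)).2
  rw [alternant_mul_schurPoly hbot, Finset.sum_eq_single_of_mem
    (⟨ReverseTableau.standardFilling nu, hbd⟩ : BoundedReverseTableau n nu)]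
  · congr 1
    funext m
    simp only [Pi.add_apply, shiftedRowLen, BoundedReverseTableau.weight, hw]
    omega
  · exact Finset.mem_filter.2 ⟨Finset.mem_univ _, ReverseTableau.dominant_standardFilling ⊥⟩
  · intro T hT hne
    obtain ⟨nu', h'⟩ := ReverseTableau.exists_isYamanouchiSymbol_columnWord
      (Finset.mem_filter.1 hT).2
    exact absurd (Subtype.ext (ReverseTableau.isYamanouchiSymbol_bot_iff.1 h').2) hne

theorem coeff_alternant_bot_mul_schurPoly {n : ℕ} {nu nu' : YoungDiagram} [Decidable (nu = nu')]
    (h : nu.colLen 0 ≤ n) (h' : nu'.colLen 0 ≤ n) :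
    MvPolynomial.coeff (Finsupp.equivFunOnFinite.symm (shiftedRowLen n nu'))
      (alternant (shiftedRowLen n ⊥) * schurPoly n nu) = if nu = nu' then 1 else 0 := by
  rw [alternant_bot_mul_schurPoly h,
    coeff_alternant (strictAnti_shiftedRowLen nu) (strictAnti_shiftedRowLen nu')]
  simp only [shiftedRowLen_inj h h']

/-- The Schur functions are linearly independent. -/
theorem eq_zero_of_sum_schurPoly_eq_zero {c : YoungDiagram →₀ ℤ}
    (h : ∀ n, Finsupp.linearCombination ℤ (schurPoly n) c = 0) : c = 0 := by
  classical
  ext nu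
  rw [Finsupp.coe_zero, Pi.zero_apply]
  by_contra hne
  have hmem : nu ∈ c.support := Finsupp.mem_support_iff.2 hne
  set n := c.support.sup fun nu => nu.colLen 0 with hn
  have hle : ∀ nu' ∈ c.support, nu'.colLen 0 ≤ n := fun nu' h' =>
    Finset.le_sup (f := fun nu : YoungDiagram => nu.colLen 0) h'
  have h₁ := congrArg (fun p => MvPolynomial.coeff
    (Finsupp.equivFunOnFinite.symm (shiftedRowLen n nu)) (alternant (shiftedRowLen n ⊥) * p)) (h n)
  simp only [Finsupp.linearCombination_apply, Finsupp.sum, Finset.mul_sum, mul_smul_comm,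
    MvPolynomial.coeff_sum, MvPolynomial.coeff_smul, mul_zero, MvPolynomial.coeff_zero] at h₁
  rw [Finset.sum_congr rfl fun nu' h' => by
    rw [coeff_alternant_bot_mul_schurPoly (hle nu' h') (hle nu hmem)]] at h₁
  simp only [smul_eq_mul, mul_ite, mul_one, mul_zero, Finset.sum_ite_eq', hmem, if_true] at h₁
  exact hne h₁

/-! ### Products of Schur polynomials -/

theorem IsYamanouchiSymbol.right_unique {mu nu nu' : YoungDiagram} {w : List ℕ}
    (h : IsYamanouchiSymbol mu nu w) (h' : IsYamanouchiSymbol mu nu' w) : nu = nu' :=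
  YoungDiagram.eq_of_rowLen fun i => (h.rowLen i).trans (h'.rowLen i).symm

theorem YoungDiagram.colLen_le_card (nu : YoungDiagram) (j : ℕ) : nu.colLen j ≤ nu.card := by
  rw [YoungDiagram.colLen_eq_card]
  exact Finset.card_le_card (Finset.filter_subset _ _)

namespace ReverseTableau

variable {lam : YoungDiagram}

theorem finite_entry_le (lam : YoungDiagram) (n : ℕ) :
    {T : ReverseTableau lam | ∀ i j, T.entry i j ≤ n}.Finite :=
  Set.finite_coe_iff.1 (inferInstanceAs (Finite (BoundedReverseTableau n lam)))

theorem finite_isYamanouchiSymbol (lam mu : YoungDiagram) :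
    {T : ReverseTableau lam | ∃ nu, IsYamanouchiSymbol mu nu T.columnWord}.Finite := by
  refine (finite_entry_le lam (mu.card + lam.card)).subset ?_
  rintro T ⟨nu, h⟩ i j
  have h₁ := entry_le_colLen h i j
  have h₂ := nu.colLen_le_card 0
  have h₃ := h.card
  rw [length_columnWord] at h₃
  omega

/-- The final diagram of the chain that starts at `mu` and has the column word of `T` as its
Yamanouchi symbol; the empty diagram when there is no such chain. -/
noncomputable def endDiagram (T : ReverseTableau lam) (mu : YoungDiagram) : YoungDiagram :=
  open Classical in
  if h : ∃ nu, IsYamanouchiSymbol mu nu T.columnWord then h.choose else ⊥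

theorem endDiagram_eq {T : ReverseTableau lam} {mu nu : YoungDiagram}
    (h : IsYamanouchiSymbol mu nu T.columnWord) : T.endDiagram mu = nu := by
  have hex : ∃ nu, IsYamanouchiSymbol mu nu T.columnWord := ⟨nu, h⟩
  rw [endDiagram, dif_pos hex]
  exact hex.choose_spec.right_unique h

end ReverseTableau

theorem colLen_le_of_isYamanouchiSymbol {mu nu : YoungDiagram} {w : List ℕ}
    (h : IsYamanouchiSymbol mu nu w) : mu.colLen 0 ≤ nu.colLen 0 := by
  refine YoungDiagram.colLen_le_of_rowLen_eq_zero ?_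
  have h₁ := h.rowLen (nu.colLen 0)
  rw [YoungDiagram.rowLen_eq_zero le_rfl] at h₁
  omega

/-- Comparing alternants gives the expansion of a product of Schur polynomials in any number of
variables; tableaux with an entry greater than `n` contribute zero on the right-hand side. -/
theorem schurPoly_mul_schurPoly (n : ℕ) (lam mu : YoungDiagram) :
    schurPoly n lam * schurPoly n mu =
      ∑ T ∈ (ReverseTableau.finite_isYamanouchiSymbol lam mu).toFinset,
        schurPoly n (T.endDiagram mu) := by
  classical
  rcases lt_or_ge n (mu.colLen 0) with hmu | hmu
  · rw [schurPoly_eq_zero hmu, mul_zero]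
    refine (Finset.sum_eq_zero fun T hT => schurPoly_eq_zero ?_).symm
    obtain ⟨nu, h⟩ := (Set.Finite.mem_toFinset _).1 hT
    rw [ReverseTableau.endDiagram_eq h]
    exact hmu.trans_le (colLen_le_of_isYamanouchiSymbol h)
  refine mul_left_cancel₀ (alternant_shiftedRowLen_ne_zero (n := n) ⊥) ?_
  rw [mul_left_comm, alternant_bot_mul_schurPoly hmu, mul_comm, alternant_mul_schurPoly hmu,
    Finset.mul_sum]
  have hsub : ∀ T ∈ (ReverseTableau.finite_isYamanouchiSymbol lam mu).toFinset,
      alternant (shiftedRowLen n ⊥) * schurPoly n (T.endDiagram mu) ≠ 0 →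
        ∀ i j, T.entry i j ≤ n := by
    intro T hT hne i j
    obtain ⟨nu, h⟩ := (Set.Finite.mem_toFinset _).1 hT
    rw [ReverseTableau.endDiagram_eq h] at hne
    refine (ReverseTableau.entry_le_colLen h i j).trans ?_
    by_contra! hlt
    rw [schurPoly_eq_zero hlt, mul_zero] at hne
    exact hne rfl
  rw [← Finset.sum_filter_of_ne hsub]
  refine Finset.sum_bij (fun T _ => T.1) ?_ (fun _ _ _ _ => Subtype.ext) ?_ ?_
  · intro T hT
    rw [Finset.mem_filter, Set.Finite.mem_toFinset]
    exact ⟨ReverseTableau.exists_isYamanouchiSymbol_columnWord (Finset.mem_filter.1 hT).2, T.2⟩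
  · intro T hT
    rw [Finset.mem_filter, Set.Finite.mem_toFinset] at hT
    obtain ⟨⟨nu, h⟩, hb⟩ := hT
    exact ⟨⟨T, hb⟩, Finset.mem_filter.2 ⟨Finset.mem_univ _,
      ReverseTableau.dominant_of_isYamanouchiSymbol h⟩, rfl⟩
  · intro T hT
    obtain ⟨nu, h⟩ :=
      ReverseTableau.exists_isYamanouchiSymbol_columnWord (Finset.mem_filter.1 hT).2
    have hrow := ReverseTableau.rowLen_of_isYamanouchiSymbol h
    have hnu : nu.colLen 0 ≤ n := YoungDiagram.colLen_le_of_rowLen_eq_zero (by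
      rw [hrow, YoungDiagram.rowLen_eq_zero hmu, ReverseTableau.weight_eq_zero T.2 le_rfl])
    rw [ReverseTableau.endDiagram_eq h, alternant_bot_mul_schurPoly hnu]
    congr 1
    funext m
    simp only [Pi.add_apply, shiftedRowLen, BoundedReverseTableau.weight, hrow]
    omega

theorem isSchurProductExpansion_iff {lam mu : YoungDiagram} {c : YoungDiagram →₀ ℤ} :
    IsSchurProductExpansion lam mu c ↔
      ∀ n, schurPoly n lam * schurPoly n mu = Finsupp.linearCombination ℤ (schurPoly n) c :=
  Iff.rfl

theorem IsSchurProductExpansion.unique {lam mu : YoungDiagram} {c c' : YoungDiagram →₀ ℤ}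
    (h : IsSchurProductExpansion lam mu c) (h' : IsSchurProductExpansion lam mu c') : c = c' := by
  rw [isSchurProductExpansion_iff] at h h'
  exact sub_eq_zero.1 (eq_zero_of_sum_schurPoly_eq_zero fun n => by
    rw [map_sub, ← h n, ← h' n, sub_self])

/-- The Littlewood–Richardson coefficients, as numbers of reverse tableaux. -/
noncomputable def schurProductCoeff (lam mu : YoungDiagram) : YoungDiagram →₀ ℤ :=
  ∑ T ∈ (ReverseTableau.finite_isYamanouchiSymbol lam mu).toFinset,
    Finsupp.single (T.endDiagram mu) 1

theorem isSchurProductExpansion_schurProductCoeff (lam mu : YoungDiagram) :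
    IsSchurProductExpansion lam mu (schurProductCoeff lam mu) := by
  rw [isSchurProductExpansion_iff]
  intro n
  rw [schurProductCoeff, map_sum, schurPoly_mul_schurPoly]
  simp only [Finsupp.linearCombination_single, one_smul]

theorem schurProductCoeff_apply (lam mu nu : YoungDiagram) :
    schurProductCoeff lam mu nu =
      ({T : ReverseTableau lam | IsYamanouchiSymbol mu nu T.columnWord}.ncard : ℤ) := by
  classical
  rw [schurProductCoeff, Finsupp.finsetSum_apply]
  simp only [Finsupp.single_apply]
  rw [Finset.sum_boole, Nat.cast_inj, ← Set.ncard_coe_finset]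
  congr 1
  ext T
  simp only [Finset.coe_filter, Set.Finite.mem_toFinset, Set.mem_ofPred_eq]
  constructor
  · rintro ⟨⟨nu', h⟩, rfl⟩
    rwa [ReverseTableau.endDiagram_eq h]
  · exact fun h => ⟨⟨nu, h⟩, ReverseTableau.endDiagram_eq h⟩

theorem corollary2p9 (lam mu : YoungDiagram) :
    (∃! c : YoungDiagram →₀ ℤ, IsSchurProductExpansion lam mu c) ∧
    ∀ c : YoungDiagram →₀ ℤ, IsSchurProductExpansion lam mu c →
      ∀ nu : YoungDiagram, nu.card = lam.card + mu.card →
        {T : ReverseTableau lam | IsYamanouchiSymbol mu nu T.columnWord}.Finite ∧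
        c nu = ({T : ReverseTableau lam |
          T.IsBounded nu ∧ IsYamanouchiSymbol mu nu T.columnWord}.ncard : ℤ) ∧
        c nu = ({T : ReverseTableau lam |
          IsYamanouchiSymbol mu nu T.columnWord}.ncard : ℤ) := by
 
  have hc₀ := isSchurProductExpansion_schurProductCoeff lam mu
  refine ⟨⟨_, hc₀, fun c hc => hc.unique hc₀⟩, fun c hc nu _ => ?_⟩
  obtain rfl := hc.unique hc₀
  refine ⟨(ReverseTableau.finite_isYamanouchiSymbol lam mu).subset fun T hT => ⟨nu, hT⟩, ?_,
    schurProductCoeff_apply lam mu nu⟩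
  rw [schurProductCoeff_apply]
  congr 2
  ext T
  exact ⟨fun h => ⟨ReverseTableau.isBounded_of_isYamanouchiSymbol h, h⟩, fun h => h.2⟩
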